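/- Let $M$ be a closed (compact, without boundary) smooth $n$-dimensional manifold and let $\psi:M\to S^{n+p}\subset\mathbb R^{n+p+1}$ be a smooth immersion into the unit sphere, equipped with the induced metric. Let $II$ be its second fundamental form in $S^{n+p}$, $A$ its shape operator, and $T^\perp M$ its normal bundle in $S^{n+p}$. Assume that $\psi$ is minimal ($\operatorname{tr} II=0$) and not totally geodesic ($II\not\equiv 0$). Let $$\mathcal L=\Delta^{\perp}+n+\tilde{\mathcal A},\qquad \langle\tilde{\mathcal A}(V),W\rangle=\langle A_V,A_W\rangle ,$$ be the Jacobi operator on smooth sections of $T^\perp M$, where $\Delta^\perp$ is the (trace) Laplacian of the normal connection, and for $\mu\in\mathbb R$ let $\mathfrak E_\mu=\operatorname{Span}_{\mathbb R}\{V\in\Gamma(T^\perp M): \mathcal L V+\mu V=0\}$. Then $$\dim \mathfrak E_{-n}\ \ge\ n+p+1 ,$$ and hence $$\operatorname{Ind}(\psi)\ \ge\ n+p+1 ,$$ where $\operatorname{Ind}(\psi)$ is the Morse index of $\psi$, that is, the maximal dimension of a space of smooth normal sections on which $Q(V,V)=-\int_M\langle\mathcal L V,V\rangle\,dA$ is negative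 definite; the same lower bound holds for $\sum_{\mu<0}\dim\mathfrak E_\mu$. -/

import Mathlib

open scoped Manifold ContDiff RealInnerProductSpace
open MeasureTheory

noncomputable section

/-- A smooth immersion `ψ : Mⁿ → S^{n+p}` into the unit sphere of `ℝ^{n+p+1}`. -/
structure SphereImmersion (n p : ℕ) (M : Type*) [TopologicalSpace M]
    [ChartedSpace (EuclideanSpace ℝ (Fin n)) M] where
  toFun : M → Metric.sphere (0 : EuclideanSpace ℝ (Fin (n + p + 1))) 1
  contMDiff_toFun : ContMDiff (𝓡 n) (𝓡 (n + p)) ∞ toFun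
  injective_mfderiv : ∀ x, Function.Injective (mfderiv (𝓡 n) (𝓡 (n + p)) toFun x)

namespace SphereImmersion

variable {n p : ℕ} {M : Type*} [TopologicalSpace M]
  [ChartedSpace (EuclideanSpace ℝ (Fin n)) M]

/-- The position vector `M → ℝ^{n+p+1}` of the immersion. -/
def pos (ψ : SphereImmersion n p M) (x : M) : EuclideanSpace ℝ (Fin (n + p + 1)) :=
  (ψ.toFun x : EuclideanSpace ℝ (Fin (n + p + 1)))

/-- The differential of the position vector at `x`. -/
def dpos (ψ : SphereImmersion n p M) (x : M) :
    TangentSpace (𝓡 n) x →L[ℝ] EuclideanSpace ℝ (Fin (n + p + 1)) :=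
  mfderiv (𝓡 n) 𝓘(ℝ, EuclideanSpace ℝ (Fin (n + p + 1))) ψ.pos x

theorem dpos_injective (ψ : SphereImmersion n p M) (x : M) :
    Function.Injective (ψ.dpos x) := by
  have := Fact.mk (@finrank_euclideanSpace_fin ℝ _ (n + p + 1))
  have h1 : MDifferentiableAt (𝓡 (n + p)) 𝓘(ℝ, EuclideanSpace ℝ (Fin (n + p + 1)))
      ((↑) : Metric.sphere (0 : EuclideanSpace ℝ (Fin (n + p + 1))) 1 →
        EuclideanSpace ℝ (Fin (n + p + 1))) (ψ.toFun x) :=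
    (contMDiff_coe_sphere (E := EuclideanSpace ℝ (Fin (n + p + 1))) (m := 1)
      (n := n + p)).mdifferentiable one_ne_zero _
  have h2 : MDifferentiableAt (𝓡 n) (𝓡 (n + p)) ψ.toFun x :=
    ψ.contMDiff_toFun.mdifferentiable (by simp) x
  have h3 := mfderiv_comp x h1 h2
  have h4 : ψ.dpos x = _ := h3
  rw [h4]
  exact (injective_mvfderiv_subtypeVal_sphere (n := n + p) (ψ.toFun x)).comp (ψ.injective_mfderiv x)

/-- The tangent space of the submanifold at `x`, as a subspace of `ℝ^{n+p+1}`. -/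
def tangent (ψ : SphereImmersion n p M) (x : M) :
    Submodule ℝ (EuclideanSpace ℝ (Fin (n + p + 1))) :=
  LinearMap.range (ψ.dpos x).toLinearMap

/-- The fibre at `x` of the normal bundle of the submanifold in the sphere: the vectors orthogonal
to the tangent space and to the position vector. -/
def normal (ψ : SphereImmersion n p M) (x : M) :
    Submodule ℝ (EuclideanSpace ℝ (Fin (n + p + 1))) :=
  (ψ.tangent x ⊔ Submodule.span ℝ {ψ.pos x})ᗮ

/-- The differential of the immersion, as an isomorphism onto the tangent space. The Riemannian
metric of `M` is the one that makes it an isometry. -/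
def tangentEquiv (ψ : SphereImmersion n p M) (x : M) :
    TangentSpace (𝓡 n) x ≃ₗ[ℝ] ψ.tangent x :=
  LinearEquiv.ofInjective (ψ.dpos x).toLinearMap (ψ.dpos_injective x)

/-- The tangential part `v^T` at `x` of `v ∈ ℝ^{n+p+1}`, as a tangent vector of `M`. -/
def tangentialPart (ψ : SphereImmersion n p M) (x : M)
    (v : EuclideanSpace ℝ (Fin (n + p + 1))) : TangentSpace (𝓡 n) x :=
  (ψ.tangentEquiv x).symm ((ψ.tangent x).orthogonalProjectionOnto v)

/-- The normal part `v^⊥` at `x` of `v ∈ ℝ^{n+p+1}`. -/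
def normalPart (ψ : SphereImmersion n p M) (x : M)
    (v : EuclideanSpace ℝ (Fin (n + p + 1))) : EuclideanSpace ℝ (Fin (n + p + 1)) :=
  (ψ.normal x).starProjection v

/-- The derivative `D_u V` at `x` of a map `V : M → ℝ^{n+p+1}`. -/
def ambientDeriv (_ψ : SphereImmersion n p M) (V : M → EuclideanSpace ℝ (Fin (n + p + 1)))
    (x : M) (u : TangentSpace (𝓡 n) x) : EuclideanSpace ℝ (Fin (n + p + 1)) :=
  mfderiv (𝓡 n) 𝓘(ℝ, EuclideanSpace ℝ (Fin (n + p + 1))) V x u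

/-- The normal connection `∇^⊥_u V = (D_u V)^⊥`. -/
def normalConnection (ψ : SphereImmersion n p M) (V : M → EuclideanSpace ℝ (Fin (n + p + 1)))
    (x : M) (u : TangentSpace (𝓡 n) x) : EuclideanSpace ℝ (Fin (n + p + 1)) :=
  ψ.normalPart x (ψ.ambientDeriv V x u)

/-- The Levi-Civita connection of the induced metric, `∇_u W = (D_u (dψ W))^T`. -/
def leviCivita (ψ : SphereImmersion n p M) (W : ∀ y : M, TangentSpace (𝓡 n) y)
    (x : M) (u : TangentSpace (𝓡 n) x) : TangentSpace (𝓡 n) x :=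
  ψ.tangentialPart x (ψ.ambientDeriv (fun y => ψ.dpos y (W y)) x u)

/-- A vector field on `M` whose value at `x` is `w`: the tangential part of the constant vector
`dψ_x w`. It serves to evaluate tensors that are given by formulas in vector fields and that do
not depend on the choice of the extension of `w`. -/
def extend (ψ : SphereImmersion n p M) (x : M) (w : TangentSpace (𝓡 n) x) (y : M) :
    TangentSpace (𝓡 n) y :=
  ψ.tangentialPart y (ψ.dpos x w)

theorem extend_self (ψ : SphereImmersion n p M) (x : M) (w : TangentSpace (𝓡 n) x) :
    ψ.extend x w x = w := by
  have h : (ψ.tangent x).orthogonalProjectionOnto (ψ.dpos x w) = ψ.tangentEquiv x w :=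
    Submodule.orthogonalProjectionOnto_mem_subspace_eq_self (ψ.tangentEquiv x w)
  simp [extend, tangentialPart, h]

/-- The second fundamental form `II(u, w) = (D_u (dψ W))^⊥`, with `W` extending `w`. -/
def secondFundamentalForm (ψ : SphereImmersion n p M) (x : M) (u w : TangentSpace (𝓡 n) x) :
    EuclideanSpace ℝ (Fin (n + p + 1)) :=
  ψ.normalPart x (ψ.ambientDeriv (fun y => ψ.dpos y (ψ.extend x w y)) x u)

/-- The second covariant derivative
`(∇²V)(u, w) = ∇^⊥_u ∇^⊥_W V - ∇^⊥_{∇_u W} V`, with `W` extending `w`. -/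
def normalHessian (ψ : SphereImmersion n p M) (V : M → EuclideanSpace ℝ (Fin (n + p + 1)))
    (x : M) (u w : TangentSpace (𝓡 n) x) : EuclideanSpace ℝ (Fin (n + p + 1)) :=
  ψ.normalConnection (fun y => ψ.normalConnection V y (ψ.extend x w y)) x u
    - ψ.normalConnection V x (ψ.leviCivita (ψ.extend x w) x u)

/-- An orthonormal basis `e_i` of `T_x M` for the induced metric. -/
def frame (ψ : SphereImmersion n p M) (x : M) (i : Fin (Module.finrank ℝ (ψ.tangent x))) :
    TangentSpace (𝓡 n) x :=
  (ψ.tangentEquiv x).symm (stdOrthonormalBasis ℝ (ψ.tangent x) i)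

/-- The mean curvature vector `H = (1/n) tr II`. -/
def meanCurvature (ψ : SphereImmersion n p M) (x : M) : EuclideanSpace ℝ (Fin (n + p + 1)) :=
  (n : ℝ)⁻¹ • ∑ i, ψ.secondFundamentalForm x (ψ.frame x i) (ψ.frame x i)

/-- The submanifold is minimal: its mean curvature vector vanishes. -/
def IsMinimal (ψ : SphereImmersion n p M) : Prop := ∀ x, ψ.meanCurvature x = 0

/-- The submanifold is totally geodesic: its second fundamental form vanishes. -/
def IsTotallyGeodesic (ψ : SphereImmersion n p M) : Prop :=
  ∀ x, ∀ u w : TangentSpace (𝓡 n) x, ψ.secondFundamentalForm x u w = 0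

/-- The shape operator `A_ξ`, given by `⟨A_ξ u, w⟩ = ⟨II(u, w), ξ⟩`. -/
def shapeOperator (ψ : SphereImmersion n p M) (x : M)
    (ξ : EuclideanSpace ℝ (Fin (n + p + 1))) (u : TangentSpace (𝓡 n) x) :
    TangentSpace (𝓡 n) x :=
  ∑ j, ⟪ψ.secondFundamentalForm x u (ψ.frame x j), ξ⟫ • ψ.frame x j

/-- The operator `Ã` on normal vectors with `⟨Ã ξ, η⟩ = ⟨A_ξ, A_η⟩`
(see `inner_simonsOperator`). -/
def simonsOperator (ψ : SphereImmersion n p M) (x : M)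
    (ξ : EuclideanSpace ℝ (Fin (n + p + 1))) : EuclideanSpace ℝ (Fin (n + p + 1)) :=
  ∑ i, ∑ j, ⟪ψ.secondFundamentalForm x (ψ.frame x i) (ψ.frame x j), ξ⟫ •
    ψ.secondFundamentalForm x (ψ.frame x i) (ψ.frame x j)

theorem inner_simonsOperator (ψ : SphereImmersion n p M) (x : M)
    (ξ η : EuclideanSpace ℝ (Fin (n + p + 1))) :
    ⟪ψ.simonsOperator x ξ, η⟫ =
      ∑ i, ⟪ψ.dpos x (ψ.shapeOperator x ξ (ψ.frame x i)),
        ψ.dpos x (ψ.shapeOperator x η (ψ.frame x i))⟫ := by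
  have hf : ∀ j, ψ.dpos x (ψ.frame x j) = (stdOrthonormalBasis ℝ (ψ.tangent x) j : _) := by
    intro j
    have := congrArg Subtype.val
      ((ψ.tangentEquiv x).apply_symm_apply (stdOrthonormalBasis ℝ (ψ.tangent x) j))
    exact this
  have ho : Orthonormal ℝ (fun j => ψ.dpos x (ψ.frame x j)) := by
    simp only [hf]
    exact (stdOrthonormalBasis ℝ (ψ.tangent x)).orthonormal.comp_linearIsometry
      (ψ.tangent x).subtypeₗᵢ
  simp only [simonsOperator, shapeOperator, sum_inner, map_sum, map_smul]
  refine Finset.sum_congr rfl fun i _ => ?_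
  have := ho.inner_sum
    (fun j => ⟪ψ.secondFundamentalForm x (ψ.frame x i) (ψ.frame x j), ξ⟫)
    (fun j => ⟪ψ.secondFundamentalForm x (ψ.frame x i) (ψ.frame x j), η⟫) Finset.univ
  simp only [sum_inner] at this
  rw [this]
  simp [inner_smul_left]

/-- The Laplace operator of the normal bundle, `Δ^⊥ V = ∑ i, (∇²V)(e_i, e_i)`. -/
def normalLaplacian (ψ : SphereImmersion n p M) (V : M → EuclideanSpace ℝ (Fin (n + p + 1)))
    (x : M) : EuclideanSpace ℝ (Fin (n + p + 1)) :=
  ∑ i, ψ.normalHessian V x (ψ.frame x i) (ψ.frame x i)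

/-- The Jacobi operator `L = Δ^⊥ + n + Ã`. -/
def jacobi (ψ : SphereImmersion n p M) (V : M → EuclideanSpace ℝ (Fin (n + p + 1)))
    (x : M) : EuclideanSpace ℝ (Fin (n + p + 1)) :=
  ψ.normalLaplacian V x + (n : ℝ) • V x + ψ.simonsOperator x (V x)

/-- The space of smooth sections of the normal bundle. -/
def normalSections (ψ : SphereImmersion n p M) :
    Submodule ℝ (M → EuclideanSpace ℝ (Fin (n + p + 1))) where
  carrier := {V | ContMDiff (𝓡 n) 𝓘(ℝ, EuclideanSpace ℝ (Fin (n + p + 1))) ∞ V ∧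
    ∀ x, V x ∈ ψ.normal x}
  add_mem' ha hb := ⟨ha.1.add hb.1, fun x => add_mem (ha.2 x) (hb.2 x)⟩
  zero_mem' := ⟨contMDiff_const, fun _ => zero_mem _⟩
  smul_mem' c _ ha := ⟨(contDiff_const_smul (𝕜 := ℝ) c).contMDiff.comp ha.1, fun x => Submodule.smul_mem _ c (ha.2 x)⟩

/-- The eigenspace of the Jacobi operator for `μ`: the span of the smooth normal sections `V`
with `L V + μ V = 0`. -/
def eigenspace (ψ : SphereImmersion n p M) (μ : ℝ) : Submodule ℝ ψ.normalSections :=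
  Submodule.span ℝ {V | ∀ x, ψ.jacobi V.1 x + μ • V.1 x = 0}

/-- The Riemannian volume density `√(det g_ij)` in the coordinates of the chart at `c`. -/
def chartDensity (ψ : SphereImmersion n p M) (c : M) (y : EuclideanSpace ℝ (Fin n)) : ℝ :=
  Real.sqrt (Matrix.det (Matrix.of fun i j : Fin n =>
    ⟪fderiv ℝ (ψ.pos ∘ (extChartAt (𝓡 n) c).symm) y (EuclideanSpace.single i 1),
      fderiv ℝ (ψ.pos ∘ (extChartAt (𝓡 n) c).symm) y (EuclideanSpace.single j 1)⟫))

/-- The Riemannian measure on the domain of the chart at `c`. -/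
def chartVolume [MeasurableSpace M] (ψ : SphereImmersion n p M) (c : M) : Measure M :=
  Measure.map (extChartAt (𝓡 n) c).symm
    ((volume.restrict (extChartAt (𝓡 n) c).target).withDensity
      fun y => ENNReal.ofReal (ψ.chartDensity c y))

/-- The Riemannian measure of the induced metric, put together from the charts with a smooth
partition of unity `ρ` subordinate to the chart domains: `∑ c, ρ_c √(det g_ij) dy`. It does not
depend on the choice of `ρ`. -/
def riemannianVolume [MeasurableSpace M] [IsManifold (𝓡 n) ∞ M] [T2Space M] [SigmaCompactSpace M]
    (ψ : SphereImmersion n p M) : Measure M :=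
  Measure.sum fun c => (ψ.chartVolume c).withDensity fun x => ENNReal.ofReal
    ((SmoothPartitionOfUnity.exists_isSubordinate_chartAt_source (𝓡 n) M).choose c x)

/-- The second variation of the volume, `Q(V, V) = -∫ ⟨L V, V⟩ dA`. -/
def indexForm [MeasurableSpace M] [IsManifold (𝓡 n) ∞ M] [T2Space M] [SigmaCompactSpace M]
    (ψ : SphereImmersion n p M) (V : ψ.normalSections) : ℝ :=
  -∫ x, ⟪ψ.jacobi V.1 x, V.1 x⟫ ∂ψ.riemannianVolume

/-- The Morse index: the maximal dimension of a space of normal sections on which `Q` is negative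
definite. -/
def index [MeasurableSpace M] [IsManifold (𝓡 n) ∞ M] [T2Space M] [SigmaCompactSpace M]
    (ψ : SphereImmersion n p M) : Cardinal :=
  ⨆ W : {W : Submodule ℝ ψ.normalSections // ∀ V ∈ W, V ≠ 0 → ψ.indexForm V < 0},
    Module.rank ℝ W.1

/-- The index as the number of negative eigenvalues of the Jacobi operator, counted with
multiplicity: the sum of the dimensions of the eigenspaces for `μ < 0`. -/
def spectralIndex (ψ : SphereImmersion n p M) : Cardinal :=
  Cardinal.sum fun μ : Set.Iio (0 : ℝ) => Module.rank ℝ (ψ.eigenspace μ)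

end SphereImmersion

end

/-! For a constant vector `a` let `a^⊥` be its normal part along the immersion. These sections span
the required space because of two facts.

Each `a^⊥` satisfies `L a^⊥ = n a^⊥` (`IsMinimal.jacobi_constNormal`). The Hessian of `a^⊥` in a
direction `c` consists of a multiple of `II(c, c)`, of `(∇_{a^T} II)(c, c)` up to sign (by Codazzi),
and of a term quadratic in `II`. On taking the trace, minimality kills the first two and the third
is `-Ã a^⊥`, so `Δ^⊥ + Ã` annihilates `a^⊥`. Then `Q(a^⊥, a^⊥) = -n ∫ |a^⊥|²`, which is negative
unless `a^⊥ = 0`.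

The map `a ↦ a^⊥` is injective (`constNormal_injective`). If `a^⊥ = 0` with `a ≠ 0`, put `f = ⟨ψ,
a⟩`. The field `a^T` is the gradient of `f`, with `∇_v a^T = -f v`, and `II(a^T, ·) = 0`. For
constant `v`, `w` the section `B = II(v^T, w^T)` satisfies `∇^⊥_{a^T} B = f B`, whence `a^T(f |B|²)
= (|a|² + f²) |B|²`. At a maximum and at a minimum of `f |B|²` this forces `B = 0`, so `f |B|²`
vanishes identically, and the identity then gives `B = 0` everywhere.

All tensor calculus is done with maps into vector spaces, differentiated along tangential parts of
constant vectors. With `P` and `N` the tangential and normal projections and `P'`, `P''` the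
derivatives of `P`, one has `II(u, w) = N P'_u w`. Symmetry of `II` and Codazzi come from
commutators of such derivatives, and no local frame has to be differentiated. -/

noncomputable section

/-! ### Orthogonal projection onto the range of an injective map, and its smooth dependence on the
map -/

namespace ContinuousLinearMap

variable {E F : Type*} [NormedAddCommGroup E] [InnerProductSpace ℝ E] [FiniteDimensional ℝ E]
  [NormedAddCommGroup F] [InnerProductSpace ℝ F] [FiniteDimensional ℝ F]

/-- The left inverse `(T* T)⁻¹ T*` of an injective linear map `T`. -/
def gramLeftInverse (T : E →L[ℝ] F) : F →L[ℝ] E := (adjoint T ∘L T).inverse ∘L adjoint T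

theorem exists_equiv_adjoint_comp_self {T : E →L[ℝ] F} (hT : Function.Injective T) :
    ∃ e : E ≃L[ℝ] E, (e : E →L[ℝ] E) = adjoint T ∘L T := by
  have hi : Function.Injective (adjoint T ∘L T).toLinearMap := by
    rw [injective_iff_map_eq_zero]
    intro v hv
    have h : ⟪adjoint T (T v), v⟫ = 0 := by
      rw [show adjoint T (T v) = 0 from hv, inner_zero_left]
    rw [adjoint_inner_left, inner_self_eq_zero] at h
    exact hT (by simpa using h)
  exact ⟨(LinearEquiv.ofInjectiveEndo _ hi).toContinuousLinearEquiv, by ext v; rfl⟩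

theorem gramLeftInverse_apply {T : E →L[ℝ] F} (hT : Function.Injective T) (v : E) :
    gramLeftInverse T (T v) = v := by
  obtain ⟨e, he⟩ := exists_equiv_adjoint_comp_self hT
  have h : adjoint T (T v) = e v := by
    rw [← ContinuousLinearEquiv.coe_coe, he]; rfl
  rw [gramLeftInverse, ← he, comp_apply, h, inverse_equiv]
  simp

theorem apply_gramLeftInverse {T : E →L[ℝ] F} (hT : Function.Injective T) (v : F) :
    T (gramLeftInverse T v) = (LinearMap.range T.toLinearMap).starProjection v := by
  obtain ⟨e, he⟩ := exists_equiv_adjoint_comp_self hT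
  symm
  refine Submodule.eq_starProjection_of_mem_of_inner_eq_zero ⟨_, rfl⟩ ?_
  rintro _ ⟨w, rfl⟩
  have h : adjoint T (T (gramLeftInverse T v)) = adjoint T v := by
    have : adjoint T (T (gramLeftInverse T v)) = e (gramLeftInverse T v) := by
      rw [← ContinuousLinearEquiv.coe_coe, he]; rfl
    rw [this, gramLeftInverse, ← he, comp_apply, inverse_equiv]
    simp
  rw [coe_coe, ← adjoint_inner_left, map_sub, h, sub_self, inner_zero_left]

/-- Taking adjoints, as a continuous linear map over `ℝ`. -/
def adjointCLM : (E →L[ℝ] F) →L[ℝ] (F →L[ℝ] E) :=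
  LinearMap.toContinuousLinearMap
    { toFun := fun T => adjoint T
      map_add' := fun S T => map_add _ S T
      map_smul' := fun c T => by simp }

/-- Inversion is smooth at the invertible operator `T* T`. Through this the tangential projection
depends smoothly on the point, without orthonormalising a frame. -/
theorem contDiffAt_gramLeftInverse {T : E →L[ℝ] F} (hT : Function.Injective T) {m : WithTop ℕ∞} :
    ContDiffAt ℝ m (gramLeftInverse : (E →L[ℝ] F) → (F →L[ℝ] E)) T := by
  obtain ⟨e, he⟩ := exists_equiv_adjoint_comp_self hT
  have h1 : ContDiffAt ℝ m (fun S : E →L[ℝ] F => adjoint S) T :=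
    (adjointCLM (E := E) (F := F)).contDiff.contDiffAt
  have h2 : ContDiffAt ℝ m (fun S : E →L[ℝ] F => adjoint S ∘L S) T := h1.clm_comp contDiffAt_id
  have h3 : ContDiffAt ℝ m (fun S : E →L[ℝ] F => (adjoint S ∘L S).inverse) T := by
    have := contDiffAt_map_inverse (𝕜 := ℝ) (n := m) e
    rw [he] at this
    exact ContDiffAt.comp (g := inverse) (f := fun S : E →L[ℝ] F => adjoint S ∘L S) T this h2
  exact h3.clm_comp h1

end ContinuousLinearMap

/-! ### Commutators of directional derivatives in a vector space -/

section Flat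

variable {E F G : Type*} [NormedAddCommGroup E] [NormedSpace ℝ E]
  [NormedAddCommGroup F] [NormedSpace ℝ F] [NormedAddCommGroup G] [NormedSpace ℝ G]

/-- The derivative of a function along a vector field is differentiated by the Leibniz rule. -/
theorem fderiv_fderiv_apply_field {g : E → G} {Q : E → E} {z : E}
    (hg : ContDiffAt ℝ 2 g z) (hQ : DifferentiableAt ℝ Q z) (v : E) :
    fderiv ℝ (fun y => fderiv ℝ g y (Q y)) z v =
      fderiv ℝ (fderiv ℝ g) z v (Q z) + fderiv ℝ g z (fderiv ℝ Q z v) := by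
  have h : DifferentiableAt ℝ (fderiv ℝ g) z :=
    (hg.fderiv_right (m := 1) (by norm_num)).differentiableAt one_ne_zero
  rw [fderiv_clm_apply h hQ]
  simp [add_comm]

/-- The commutator of two directional derivatives is the derivative along the bracket. -/
theorem fderiv_commutator {g : E → G} {Q R : E → E} {z : E}
    (hg : ContDiffAt ℝ 2 g z) (hQ : DifferentiableAt ℝ Q z) (hR : DifferentiableAt ℝ R z) :
    fderiv ℝ (fun y => fderiv ℝ g y (R y)) z (Q z) -
        fderiv ℝ (fun y => fderiv ℝ g y (Q y)) z (R z) =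
      fderiv ℝ g z (fderiv ℝ R z (Q z) - fderiv ℝ Q z (R z)) := by
  rw [fderiv_fderiv_apply_field hg hQ, fderiv_fderiv_apply_field hg hR,
    (hg.isSymmSndFDerivAt (by simp)).eq (Q z) (R z), map_sub]
  abel

end Flat


/-! ### Tangential derivatives in charts, and smoothness -/

namespace SphereImmersion

variable {n p : ℕ} {M : Type*} [TopologicalSpace M]
  [ChartedSpace (EuclideanSpace ℝ (Fin n)) M]
  {G H : Type*} [NormedAddCommGroup G] [NormedSpace ℝ G] [NormedAddCommGroup H] [NormedSpace ℝ H]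

/-- The derivative at `x` of a map on `M` along the tangential part of a vector of `ℝ^{n+p+1}`. -/
def tangentialDeriv (ψ : SphereImmersion n p M) (g : M → G) (x : M)
    (u : EuclideanSpace ℝ (Fin (n + p + 1))) : G :=
  mfderiv (𝓡 n) 𝓘(ℝ, G) g x (ψ.tangentialPart x u)

/-- The orthogonal projection of `ℝ^{n+p+1}` onto the tangent space at `x`. -/
def tangentProj (ψ : SphereImmersion n p M) (x : M) :
    EuclideanSpace ℝ (Fin (n + p + 1)) →L[ℝ] EuclideanSpace ℝ (Fin (n + p + 1)) :=
  (ψ.tangent x).starProjection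

theorem dpos_tangentialPart (ψ : SphereImmersion n p M) (x : M)
    (v : EuclideanSpace ℝ (Fin (n + p + 1))) :
    ψ.dpos x (ψ.tangentialPart x v) = ψ.tangentProj x v :=
  congrArg Subtype.val ((ψ.tangentEquiv x).apply_symm_apply
    ((ψ.tangent x).orthogonalProjectionOnto v))

theorem tangentialPart_dpos (ψ : SphereImmersion n p M) (x : M) (w : TangentSpace (𝓡 n) x) :
    ψ.tangentialPart x (ψ.dpos x w) = w :=
  ψ.extend_self x w

theorem contMDiff_pos (ψ : SphereImmersion n p M) :
    ContMDiff (𝓡 n) 𝓘(ℝ, EuclideanSpace ℝ (Fin (n + p + 1))) ∞ ψ.pos := by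
  have := Fact.mk (@finrank_euclideanSpace_fin ℝ _ (n + p + 1))
  exact (contMDiff_coe_sphere (E := EuclideanSpace ℝ (Fin (n + p + 1))) (m := ∞)
      (n := n + p)).comp ψ.contMDiff_toFun

theorem norm_pos (ψ : SphereImmersion n p M) (x : M) : ‖ψ.pos x‖ = 1 :=
  mem_sphere_zero_iff_norm.1 (ψ.toFun x).2

/-- The differential of the position vector in the coordinates of the chart at `c`. -/
def chartDpos (ψ : SphereImmersion n p M) (c : M) (z : EuclideanSpace ℝ (Fin n)) :
    EuclideanSpace ℝ (Fin n) →L[ℝ] EuclideanSpace ℝ (Fin (n + p + 1)) :=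
  fderiv ℝ (ψ.pos ∘ (extChartAt (𝓡 n) c).symm) z

theorem tangentialDeriv_pos (ψ : SphereImmersion n p M) (x : M)
    (v : EuclideanSpace ℝ (Fin (n + p + 1))) :
    ψ.tangentialDeriv ψ.pos x v = ψ.tangentProj x v :=
  ψ.dpos_tangentialPart x v

/-- The fields at hand are defined point by point through projections and inverses; their smoothness
is read off explicit formulas in each chart. -/
theorem contMDiff_of_eq_chart {g : M → G} (h : M → EuclideanSpace ℝ (Fin n) → G)
    (hh : ∀ c, ∀ z ∈ (extChartAt (𝓡 n) c).target, ContDiffAt ℝ ∞ (h c) z)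
    (hgh : ∀ c, ∀ y ∈ (extChartAt (𝓡 n) c).source, g y = h c (extChartAt (𝓡 n) c y)) :
    ContMDiff (𝓡 n) 𝓘(ℝ, G) ∞ g := by
  intro x
  have hx := mem_extChartAt_source (I := 𝓡 n) x
  have h1 : ContMDiffAt (𝓡 n) 𝓘(ℝ, G) ∞ (h x ∘ extChartAt (𝓡 n) x) x :=
    (hh x _ ((extChartAt (𝓡 n) x).map_source hx)).contMDiffAt.comp x contMDiffAt_extChartAt
  refine h1.congr_of_eventuallyEq ?_
  filter_upwards [(isOpen_extChartAt_source (I := 𝓡 n) x).mem_nhds hx] with y hy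
  exact hgh x y hy

variable [IsManifold (𝓡 n) ∞ M]

theorem _root_.ContMDiff.contDiffAt_comp_extChartAt_symm {g : M → G}
    (hg : ContMDiff (𝓡 n) 𝓘(ℝ, G) ∞ g) (c : M) {z : EuclideanSpace ℝ (Fin n)}
    (hz : z ∈ (extChartAt (𝓡 n) c).target) :
    ContDiffAt ℝ ∞ (g ∘ (extChartAt (𝓡 n) c).symm) z := by
  rw [← contMDiffAt_iff_contDiffAt]
  exact hg.contMDiffAt.comp z ((contMDiffOn_extChartAt_symm c).contMDiffAt
    ((isOpen_extChartAt_target c).mem_nhds hz))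

theorem mfderiv_eq_chart {g : M → G} (hg : ContMDiff (𝓡 n) 𝓘(ℝ, G) ∞ g) (c : M) {y : M}
    (hy : y ∈ (extChartAt (𝓡 n) c).source) (w : TangentSpace (𝓡 n) y) :
    (mfderiv (𝓡 n) 𝓘(ℝ, G) g y w : G) =
      fderiv ℝ (g ∘ (extChartAt (𝓡 n) c).symm) (extChartAt (𝓡 n) c y)
        (mfderiv (𝓡 n) 𝓘(ℝ, EuclideanSpace ℝ (Fin n)) (extChartAt (𝓡 n) c) y w) := by
  have hz := (extChartAt (𝓡 n) c).map_source hy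
  have h1 : g =ᶠ[nhds y] (g ∘ (extChartAt (𝓡 n) c).symm) ∘ extChartAt (𝓡 n) c := by
    filter_upwards [(isOpen_extChartAt_source (I := 𝓡 n) c).mem_nhds hy] with y' hy'
    rw [Function.comp_apply, Function.comp_apply, (extChartAt (𝓡 n) c).left_inv hy']
  have h2 : DifferentiableAt ℝ (g ∘ (extChartAt (𝓡 n) c).symm) (extChartAt (𝓡 n) c y) :=
    (hg.contDiffAt_comp_extChartAt_symm c hz).differentiableAt (by simp)
  have h3 : MDifferentiableAt (𝓡 n) 𝓘(ℝ, EuclideanSpace ℝ (Fin n)) (extChartAt (𝓡 n) c) y :=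
    (contMDiffAt_extChartAt' (n := ∞) (by rwa [extChartAt_source] at hy)).mdifferentiableAt
      (by simp)
  have h4 := mfderiv_comp y h2.mdifferentiableAt h3
  rw [mfderiv_eq_fderiv] at h4
  rw [h1.mfderiv_eq, h4]
  rfl

theorem chartDpos_injective (ψ : SphereImmersion n p M) (c : M) {z : EuclideanSpace ℝ (Fin n)}
    (hz : z ∈ (extChartAt (𝓡 n) c).target) : Function.Injective (ψ.chartDpos c z) := by
  obtain ⟨y, hy, rfl⟩ : ∃ y ∈ (extChartAt (𝓡 n) c).source, extChartAt (𝓡 n) c y = z :=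
    ⟨_, (extChartAt (𝓡 n) c).map_target hz, (extChartAt (𝓡 n) c).right_inv hz⟩
  obtain ⟨e, he⟩ := isInvertible_mfderiv_extChartAt hy
  intro a b hab
  obtain ⟨a, rfl⟩ := e.surjective a
  obtain ⟨b, rfl⟩ := e.surjective b
  have h := fun w => mfderiv_eq_chart ψ.contMDiff_pos c hy w
  congr 1
  apply ψ.dpos_injective y
  have ha := h a
  have hb := h b
  rw [← he] at ha hb
  exact ha.trans (hab.trans hb.symm)

/-- The injective map `chartDpos` sends both sides to the orthogonal projection of `v` onto the
tangent space, which is its range. -/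
theorem mfderiv_extChartAt_tangentialPart (ψ : SphereImmersion n p M) (c : M) {y : M}
    (hy : y ∈ (extChartAt (𝓡 n) c).source) (v : EuclideanSpace ℝ (Fin (n + p + 1))) :
    mfderiv (𝓡 n) 𝓘(ℝ, EuclideanSpace ℝ (Fin n)) (extChartAt (𝓡 n) c) y (ψ.tangentialPart y v) =
      (ψ.chartDpos c (extChartAt (𝓡 n) c y)).gramLeftInverse v := by
  have hz := (extChartAt (𝓡 n) c).map_source hy
  obtain ⟨e, he⟩ := isInvertible_mfderiv_extChartAt hy
  have h := fun w => mfderiv_eq_chart ψ.contMDiff_pos c hy w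
  apply ψ.chartDpos_injective c hz
  rw [ContinuousLinearMap.apply_gramLeftInverse (ψ.chartDpos_injective c hz)]
  refine (h _).symm.trans ((ψ.dpos_tangentialPart y v).trans ?_)
  have hr : ψ.tangent y = LinearMap.range (ψ.chartDpos c (extChartAt (𝓡 n) c y)).toLinearMap := by
    ext w
    constructor
    · rintro ⟨a, rfl⟩
      exact ⟨_, (h a).symm⟩
    · rintro ⟨a, rfl⟩
      obtain ⟨a, rfl⟩ := e.surjective a
      refine ⟨a, ?_⟩
      have := h a
      rw [← he] at this
      exact this
  rw [tangentProj]
  simp only [hr]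

/-- The tangential derivative in the coordinates of a chart. -/
theorem tangentialDeriv_eq_chart (ψ : SphereImmersion n p M) {g : M → G}
    (hg : ContMDiff (𝓡 n) 𝓘(ℝ, G) ∞ g) (c : M) {y : M}
    (hy : y ∈ (extChartAt (𝓡 n) c).source) (v : EuclideanSpace ℝ (Fin (n + p + 1))) :
    ψ.tangentialDeriv g y v =
      fderiv ℝ (g ∘ (extChartAt (𝓡 n) c).symm) (extChartAt (𝓡 n) c y)
        ((ψ.chartDpos c (extChartAt (𝓡 n) c y)).gramLeftInverse v) := by
  rw [← mfderiv_extChartAt_tangentialPart ψ c hy]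
  exact mfderiv_eq_chart hg c hy _

theorem tangentProj_eq_chart (ψ : SphereImmersion n p M) (c : M) {y : M}
    (hy : y ∈ (extChartAt (𝓡 n) c).source) :
    ψ.tangentProj y = ψ.chartDpos c (extChartAt (𝓡 n) c y) ∘L
      (ψ.chartDpos c (extChartAt (𝓡 n) c y)).gramLeftInverse := by
  ext1 v
  rw [← tangentialDeriv_pos, ψ.tangentialDeriv_eq_chart ψ.contMDiff_pos c hy]
  rfl

theorem contDiffAt_chartDpos (ψ : SphereImmersion n p M) (c : M) {z : EuclideanSpace ℝ (Fin n)}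
    (hz : z ∈ (extChartAt (𝓡 n) c).target) : ContDiffAt ℝ ∞ (ψ.chartDpos c) z :=
  (ψ.contMDiff_pos.contDiffAt_comp_extChartAt_symm c hz).fderiv_right (by simp)

theorem contDiffAt_gramLeftInverse_chartDpos (ψ : SphereImmersion n p M) (c : M)
    {z : EuclideanSpace ℝ (Fin n)} (hz : z ∈ (extChartAt (𝓡 n) c).target) :
    ContDiffAt ℝ ∞ (fun z => (ψ.chartDpos c z).gramLeftInverse) z :=
  ContDiffAt.comp (g := ContinuousLinearMap.gramLeftInverse) (f := ψ.chartDpos c) z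
    (ContinuousLinearMap.contDiffAt_gramLeftInverse (ψ.chartDpos_injective c hz))
    (ψ.contDiffAt_chartDpos c hz)

theorem contMDiff_tangentialDeriv (ψ : SphereImmersion n p M) {g : M → G}
    (hg : ContMDiff (𝓡 n) 𝓘(ℝ, G) ∞ g) (v : EuclideanSpace ℝ (Fin (n + p + 1))) :
    ContMDiff (𝓡 n) 𝓘(ℝ, G) ∞ (fun x => ψ.tangentialDeriv g x v) :=
  contMDiff_of_eq_chart (fun c z => fderiv ℝ (g ∘ (extChartAt (𝓡 n) c).symm) z
      ((ψ.chartDpos c z).gramLeftInverse v))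
    (fun c _ hz => ((hg.contDiffAt_comp_extChartAt_symm c hz).fderiv_right (by simp)).clm_apply
      ((ψ.contDiffAt_gramLeftInverse_chartDpos c hz).clm_apply contDiffAt_const))
    (fun c _ hy => ψ.tangentialDeriv_eq_chart hg c hy v)

theorem contMDiff_tangentProj (ψ : SphereImmersion n p M) :
    ContMDiff (𝓡 n) 𝓘(ℝ, EuclideanSpace ℝ (Fin (n + p + 1)) →L[ℝ]
      EuclideanSpace ℝ (Fin (n + p + 1))) ∞ ψ.tangentProj :=
  contMDiff_of_eq_chart (fun c z => ψ.chartDpos c z ∘L (ψ.chartDpos c z).gramLeftInverse)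
    (fun c _ hz => (ψ.contDiffAt_chartDpos c hz).clm_comp
      (ψ.contDiffAt_gramLeftInverse_chartDpos c hz))
    (fun c _ hy => ψ.tangentProj_eq_chart c hy)

end SphereImmersion


/-! ### Leibniz rules and commutators of tangential derivatives -/

namespace SphereImmersion

variable {n p : ℕ} {M : Type*} [TopologicalSpace M]
  [ChartedSpace (EuclideanSpace ℝ (Fin n)) M]
  {G H : Type*} [NormedAddCommGroup G] [NormedSpace ℝ G] [NormedAddCommGroup H] [NormedSpace ℝ H]

theorem tangentialPart_add (ψ : SphereImmersion n p M) (x : M)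
    (u v : EuclideanSpace ℝ (Fin (n + p + 1))) :
    ψ.tangentialPart x (u + v) = ψ.tangentialPart x u + ψ.tangentialPart x v := by
  simp [tangentialPart]

theorem tangentialPart_smul (ψ : SphereImmersion n p M) (x : M) (r : ℝ)
    (u : EuclideanSpace ℝ (Fin (n + p + 1))) :
    ψ.tangentialPart x (r • u) = r • ψ.tangentialPart x u := by
  simp [tangentialPart]

theorem tangentialPart_tangentProj (ψ : SphereImmersion n p M) (x : M)
    (u : EuclideanSpace ℝ (Fin (n + p + 1))) :
    ψ.tangentialPart x (ψ.tangentProj x u) = ψ.tangentialPart x u := by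
  rw [← dpos_tangentialPart, tangentialPart_dpos]

theorem tangentialDeriv_add_right (ψ : SphereImmersion n p M) (g : M → G) (x : M)
    (u v : EuclideanSpace ℝ (Fin (n + p + 1))) :
    ψ.tangentialDeriv g x (u + v) = ψ.tangentialDeriv g x u + ψ.tangentialDeriv g x v := by
  simp only [tangentialDeriv, tangentialPart_add]
  exact map_add (mfderiv (𝓡 n) 𝓘(ℝ, G) g x) _ _

theorem tangentialDeriv_smul_right (ψ : SphereImmersion n p M) (g : M → G) (x : M) (r : ℝ)
    (u : EuclideanSpace ℝ (Fin (n + p + 1))) :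
    ψ.tangentialDeriv g x (r • u) = r • ψ.tangentialDeriv g x u := by
  simp only [tangentialDeriv, tangentialPart_smul]
  exact map_smul (mfderiv (𝓡 n) 𝓘(ℝ, G) g x) _ _

/-- The tangential derivative at a point, as a linear map in the direction. -/
def tangentialDerivₗ (ψ : SphereImmersion n p M) (g : M → G) (x : M) :
    EuclideanSpace ℝ (Fin (n + p + 1)) →ₗ[ℝ] G where
  toFun := ψ.tangentialDeriv g x
  map_add' := ψ.tangentialDeriv_add_right g x
  map_smul' := ψ.tangentialDeriv_smul_right g x

theorem tangentialDeriv_sub_right (ψ : SphereImmersion n p M) (g : M → G) (x : M)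
    (u v : EuclideanSpace ℝ (Fin (n + p + 1))) :
    ψ.tangentialDeriv g x (u - v) = ψ.tangentialDeriv g x u - ψ.tangentialDeriv g x v :=
  map_sub (ψ.tangentialDerivₗ g x) u v

theorem tangentialDeriv_zero_right (ψ : SphereImmersion n p M) (g : M → G) (x : M) :
    ψ.tangentialDeriv g x 0 = 0 :=
  map_zero (ψ.tangentialDerivₗ g x)

theorem tangentialDeriv_tangentProj (ψ : SphereImmersion n p M) (g : M → G) (x : M)
    (u : EuclideanSpace ℝ (Fin (n + p + 1))) :
    ψ.tangentialDeriv g x (ψ.tangentProj x u) = ψ.tangentialDeriv g x u := by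
  rw [tangentialDeriv, tangentialPart_tangentProj, tangentialDeriv]

theorem tangentialDeriv_const (ψ : SphereImmersion n p M) (a : G) (x : M)
    (u : EuclideanSpace ℝ (Fin (n + p + 1))) :
    ψ.tangentialDeriv (fun _ => a) x u = 0 := by
  rw [tangentialDeriv, mfderiv_const]
  rfl

theorem _root_.ContMDiff.inner_euclidean {m : ℕ} {f g : M → EuclideanSpace ℝ (Fin m)}
    (hf : ContMDiff (𝓡 n) 𝓘(ℝ, EuclideanSpace ℝ (Fin m)) ∞ f)
    (hg : ContMDiff (𝓡 n) 𝓘(ℝ, EuclideanSpace ℝ (Fin m)) ∞ g) :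
    ContMDiff (𝓡 n) 𝓘(ℝ, ℝ) ∞ (fun y => ⟪f y, g y⟫) :=
  ((innerSL ℝ (E := EuclideanSpace ℝ (Fin m))).contMDiff.comp hf).clm_apply hg

variable [IsManifold (𝓡 n) ∞ M]

theorem _root_.ContMDiff.differentiableAt_chart {g : M → G}
    (hg : ContMDiff (𝓡 n) 𝓘(ℝ, G) ∞ g) (x : M) :
    DifferentiableAt ℝ (g ∘ (extChartAt (𝓡 n) x).symm) (extChartAt (𝓡 n) x x) :=
  (hg.contDiffAt_comp_extChartAt_symm x (mem_extChartAt_target x)).differentiableAt (by simp)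

theorem tangentialDeriv_eq (ψ : SphereImmersion n p M) {g : M → G}
    (hg : ContMDiff (𝓡 n) 𝓘(ℝ, G) ∞ g) (x : M) (u : EuclideanSpace ℝ (Fin (n + p + 1))) :
    ψ.tangentialDeriv g x u =
      fderiv ℝ (g ∘ (extChartAt (𝓡 n) x).symm) (extChartAt (𝓡 n) x x)
        ((ψ.chartDpos x (extChartAt (𝓡 n) x x)).gramLeftInverse u) :=
  ψ.tangentialDeriv_eq_chart hg x (mem_extChartAt_source x) u

theorem tangentialDeriv_add (ψ : SphereImmersion n p M) {f g : M → G}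
    (hf : ContMDiff (𝓡 n) 𝓘(ℝ, G) ∞ f) (hg : ContMDiff (𝓡 n) 𝓘(ℝ, G) ∞ g) (x : M)
    (u : EuclideanSpace ℝ (Fin (n + p + 1))) :
    ψ.tangentialDeriv (fun y => f y + g y) x u =
      ψ.tangentialDeriv f x u + ψ.tangentialDeriv g x u := by
  rw [ψ.tangentialDeriv_eq hf, ψ.tangentialDeriv_eq hg,
    ψ.tangentialDeriv_eq (g := fun y => f y + g y) (hf.add hg)]
  exact DFunLike.congr_fun
    (fderiv_add (hf.differentiableAt_chart x) (hg.differentiableAt_chart x)) _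

theorem tangentialDeriv_sub (ψ : SphereImmersion n p M) {f g : M → G}
    (hf : ContMDiff (𝓡 n) 𝓘(ℝ, G) ∞ f) (hg : ContMDiff (𝓡 n) 𝓘(ℝ, G) ∞ g) (x : M)
    (u : EuclideanSpace ℝ (Fin (n + p + 1))) :
    ψ.tangentialDeriv (fun y => f y - g y) x u =
      ψ.tangentialDeriv f x u - ψ.tangentialDeriv g x u := by
  rw [ψ.tangentialDeriv_eq hf, ψ.tangentialDeriv_eq hg,
    ψ.tangentialDeriv_eq (g := fun y => f y - g y) (hf.sub hg)]
  exact DFunLike.congr_fun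
    (fderiv_sub (hf.differentiableAt_chart x) (hg.differentiableAt_chart x)) _

theorem tangentialDeriv_clm_apply (ψ : SphereImmersion n p M) {A : M → H →L[ℝ] G} {g : M → H}
    (hA : ContMDiff (𝓡 n) 𝓘(ℝ, H →L[ℝ] G) ∞ A) (hg : ContMDiff (𝓡 n) 𝓘(ℝ, H) ∞ g) (x : M)
    (u : EuclideanSpace ℝ (Fin (n + p + 1))) :
    ψ.tangentialDeriv (fun y => A y (g y)) x u =
      ψ.tangentialDeriv A x u (g x) + A x (ψ.tangentialDeriv g x u) := by
  rw [ψ.tangentialDeriv_eq hA, ψ.tangentialDeriv_eq hg, ψ.tangentialDeriv_eq (hA.clm_apply hg)]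
  have h := fderiv_clm_apply (hA.differentiableAt_chart x) (hg.differentiableAt_chart x)
  refine (DFunLike.congr_fun h _).trans ?_
  simp [add_comm]

theorem tangentialDeriv_clm_apply_const (ψ : SphereImmersion n p M) {A : M → H →L[ℝ] G}
    (hA : ContMDiff (𝓡 n) 𝓘(ℝ, H →L[ℝ] G) ∞ A) (w : H) (x : M)
    (u : EuclideanSpace ℝ (Fin (n + p + 1))) :
    ψ.tangentialDeriv (fun y => A y w) x u = ψ.tangentialDeriv A x u w := by
  rw [ψ.tangentialDeriv_clm_apply hA contMDiff_const, tangentialDeriv_const, map_zero, add_zero]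

theorem tangentialDeriv_clm_comp (ψ : SphereImmersion n p M) (L : H →L[ℝ] G) {g : M → H}
    (hg : ContMDiff (𝓡 n) 𝓘(ℝ, H) ∞ g) (x : M) (u : EuclideanSpace ℝ (Fin (n + p + 1))) :
    ψ.tangentialDeriv (fun y => L (g y)) x u = L (ψ.tangentialDeriv g x u) := by
  rw [ψ.tangentialDeriv_clm_apply (A := fun _ => L) contMDiff_const hg, tangentialDeriv_const,
    zero_apply, zero_add]

theorem tangentialDeriv_smul (ψ : SphereImmersion n p M) {f : M → ℝ} {g : M → G}
    (hf : ContMDiff (𝓡 n) 𝓘(ℝ, ℝ) ∞ f) (hg : ContMDiff (𝓡 n) 𝓘(ℝ, G) ∞ g) (x : M)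
    (u : EuclideanSpace ℝ (Fin (n + p + 1))) :
    ψ.tangentialDeriv (fun y => f y • g y) x u =
      ψ.tangentialDeriv f x u • g x + f x • ψ.tangentialDeriv g x u := by
  rw [ψ.tangentialDeriv_eq hf, ψ.tangentialDeriv_eq hg,
    ψ.tangentialDeriv_eq (g := fun y => f y • g y) (hf.smul hg)]
  have h := fderiv_fun_smul (hf.differentiableAt_chart x) (hg.differentiableAt_chart x)
  refine (DFunLike.congr_fun h _).trans ?_
  simp [add_comm]

theorem tangentialDeriv_inner (ψ : SphereImmersion n p M) {m : ℕ}
    {f g : M → EuclideanSpace ℝ (Fin m)}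
    (hf : ContMDiff (𝓡 n) 𝓘(ℝ, EuclideanSpace ℝ (Fin m)) ∞ f)
    (hg : ContMDiff (𝓡 n) 𝓘(ℝ, EuclideanSpace ℝ (Fin m)) ∞ g) (x : M)
    (u : EuclideanSpace ℝ (Fin (n + p + 1))) :
    ψ.tangentialDeriv (fun y => ⟪f y, g y⟫) x u =
      ⟪ψ.tangentialDeriv f x u, g x⟫ + ⟪f x, ψ.tangentialDeriv g x u⟫ := by
  have h := ψ.tangentialDeriv_clm_apply
    ((innerSL ℝ (E := EuclideanSpace ℝ (Fin m))).contMDiff.comp hf) hg x u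
  have h' := ψ.tangentialDeriv_clm_comp (innerSL ℝ (E := EuclideanSpace ℝ (Fin m))) hf x u
  refine h.trans ?_
  rw [show ψ.tangentialDeriv (innerSL ℝ ∘ f) x u = _ from h']
  rfl

theorem tangentialDeriv_tangentialDeriv_eq (ψ : SphereImmersion n p M) {g : M → G}
    (hg : ContMDiff (𝓡 n) 𝓘(ℝ, G) ∞ g) (x : M) (v w : EuclideanSpace ℝ (Fin (n + p + 1))) :
    ψ.tangentialDeriv (fun y => ψ.tangentialDeriv g y w) x v =
      fderiv ℝ (fun z => fderiv ℝ (g ∘ (extChartAt (𝓡 n) x).symm) z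
        ((ψ.chartDpos x z).gramLeftInverse w)) (extChartAt (𝓡 n) x x)
        ((ψ.chartDpos x (extChartAt (𝓡 n) x x)).gramLeftInverse v) := by
  rw [ψ.tangentialDeriv_eq (ψ.contMDiff_tangentialDeriv hg w)]
  -- The chart formula for the inner derivative holds only on the chart target, a neighbourhood of
  -- the point, which suffices for the outer derivative.
  refine DFunLike.congr_fun (Filter.EventuallyEq.fderiv_eq ?_) _
  filter_upwards [(isOpen_extChartAt_target (I := 𝓡 n) x).mem_nhds (mem_extChartAt_target x)]
    with z hz
  rw [Function.comp_apply, ψ.tangentialDeriv_eq_chart hg x ((extChartAt (𝓡 n) x).map_target hz),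
    (extChartAt (𝓡 n) x).right_inv hz]

/-- The chart expression of the Lie bracket of the tangential parts of `v` and `w`. -/
def chartBracket (ψ : SphereImmersion n p M) (x : M) (v w : EuclideanSpace ℝ (Fin (n + p + 1))) :
    EuclideanSpace ℝ (Fin n) :=
  let Q := fun z => (ψ.chartDpos x z).gramLeftInverse
  fderiv ℝ (fun z => Q z w) (extChartAt (𝓡 n) x x) (Q (extChartAt (𝓡 n) x x) v) -
    fderiv ℝ (fun z => Q z v) (extChartAt (𝓡 n) x x) (Q (extChartAt (𝓡 n) x x) w)

theorem tangentialDeriv_comm_eq_chartBracket (ψ : SphereImmersion n p M) {g : M → G}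
    (hg : ContMDiff (𝓡 n) 𝓘(ℝ, G) ∞ g) (x : M) (v w : EuclideanSpace ℝ (Fin (n + p + 1))) :
    ψ.tangentialDeriv (fun y => ψ.tangentialDeriv g y w) x v -
      ψ.tangentialDeriv (fun y => ψ.tangentialDeriv g y v) x w =
    fderiv ℝ (g ∘ (extChartAt (𝓡 n) x).symm) (extChartAt (𝓡 n) x x) (ψ.chartBracket x v w) := by
  rw [ψ.tangentialDeriv_tangentialDeriv_eq hg, ψ.tangentialDeriv_tangentialDeriv_eq hg]
  have hQ : ∀ v, DifferentiableAt ℝ (fun z => (ψ.chartDpos x z).gramLeftInverse v)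
      (extChartAt (𝓡 n) x x) := fun v =>
    (((ψ.contDiffAt_gramLeftInverse_chartDpos x (mem_extChartAt_target x)).clm_apply
      contDiffAt_const).differentiableAt (by simp))
  exact fderiv_commutator ((hg.contDiffAt_comp_extChartAt_symm x
    (mem_extChartAt_target x)).of_le (WithTop.coe_le_coe.2 le_top)) (hQ v) (hQ w)

/-- The bracket of the tangential parts of `v` and `w`, as a vector of `ℝ^{n+p+1}`. -/
def projBracket (ψ : SphereImmersion n p M) (x : M) (v w : EuclideanSpace ℝ (Fin (n + p + 1))) :
    EuclideanSpace ℝ (Fin (n + p + 1)) :=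
  ψ.tangentialDeriv ψ.tangentProj x v w - ψ.tangentialDeriv ψ.tangentProj x w v

/-- The test function is the position vector: its derivative along `w^T` is `P w`, so its commutator
is `P'_v w - P'_w v`. This expresses the bracket by ambient data. -/
theorem chartDpos_chartBracket (ψ : SphereImmersion n p M) (x : M)
    (v w : EuclideanSpace ℝ (Fin (n + p + 1))) :
    ψ.chartDpos x (extChartAt (𝓡 n) x x) (ψ.chartBracket x v w) = ψ.projBracket x v w := by
  have h := ψ.tangentialDeriv_comm_eq_chartBracket ψ.contMDiff_pos x v w
  simp only [tangentialDeriv_pos, ψ.tangentialDeriv_clm_apply_const ψ.contMDiff_tangentProj] at h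
  exact h.symm

/-- The commutator of tangential derivatives. -/
theorem tangentialDeriv_comm (ψ : SphereImmersion n p M) {g : M → G}
    (hg : ContMDiff (𝓡 n) 𝓘(ℝ, G) ∞ g) (x : M) (v w : EuclideanSpace ℝ (Fin (n + p + 1))) :
    ψ.tangentialDeriv (fun y => ψ.tangentialDeriv g y w) x v -
      ψ.tangentialDeriv (fun y => ψ.tangentialDeriv g y v) x w =
    ψ.tangentialDeriv g x (ψ.projBracket x v w) := by
  rw [ψ.tangentialDeriv_comm_eq_chartBracket hg, ψ.tangentialDeriv_eq hg, ← chartDpos_chartBracket,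
    ContinuousLinearMap.gramLeftInverse_apply (ψ.chartDpos_injective x (mem_extChartAt_target x))]

/-- The bracket of tangent fields is tangent; this is the source of the symmetry of `II`. -/
theorem tangentProj_projBracket (ψ : SphereImmersion n p M) (x : M)
    (v w : EuclideanSpace ℝ (Fin (n + p + 1))) :
    ψ.tangentProj x (ψ.projBracket x v w) = ψ.projBracket x v w := by
  rw [ψ.tangentProj_eq_chart x (mem_extChartAt_source x), ← chartDpos_chartBracket,
    ContinuousLinearMap.comp_apply,
    ContinuousLinearMap.gramLeftInverse_apply (ψ.chartDpos_injective x (mem_extChartAt_target x))]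

end SphereImmersion


/-! ### Derivatives of the tangential projection: symmetry of `II` and Codazzi -/

namespace SphereImmersion

variable {n p : ℕ} {M : Type*} [TopologicalSpace M]
  [ChartedSpace (EuclideanSpace ℝ (Fin n)) M]

/-- The orthogonal projection of `ℝ^{n+p+1}` onto the normal space at `x`. -/
def normalProj (ψ : SphereImmersion n p M) (x : M) :
    EuclideanSpace ℝ (Fin (n + p + 1)) →L[ℝ] EuclideanSpace ℝ (Fin (n + p + 1)) :=
  (ψ.normal x).starProjection

theorem normalProj_apply_eq_self (ψ : SphereImmersion n p M) {x : M}
    {v : EuclideanSpace ℝ (Fin (n + p + 1))} (hv : v ∈ ψ.normal x) : ψ.normalProj x v = v :=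
  Submodule.starProjection_eq_self_iff.2 hv

theorem normalProj_mem (ψ : SphereImmersion n p M) (x : M)
    (v : EuclideanSpace ℝ (Fin (n + p + 1))) : ψ.normalProj x v ∈ ψ.normal x :=
  Submodule.starProjection_apply_mem _ _

theorem inner_normalProj (ψ : SphereImmersion n p M) (x : M)
    (v w : EuclideanSpace ℝ (Fin (n + p + 1))) :
    ⟪ψ.normalProj x v, w⟫ = ⟪v, ψ.normalProj x w⟫ :=
  Submodule.inner_starProjection_left_eq_right _ _ _

theorem inner_tangentProj (ψ : SphereImmersion n p M) (x : M)
    (v w : EuclideanSpace ℝ (Fin (n + p + 1))) :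
    ⟪ψ.tangentProj x v, w⟫ = ⟪v, ψ.tangentProj x w⟫ :=
  Submodule.inner_starProjection_left_eq_right _ _ _

theorem tangentProj_mem (ψ : SphereImmersion n p M) (x : M)
    (v : EuclideanSpace ℝ (Fin (n + p + 1))) : ψ.tangentProj x v ∈ ψ.tangent x :=
  Submodule.starProjection_apply_mem _ _

theorem tangentProj_apply_eq_self (ψ : SphereImmersion n p M) {x : M}
    {v : EuclideanSpace ℝ (Fin (n + p + 1))} (hv : v ∈ ψ.tangent x) : ψ.tangentProj x v = v :=
  Submodule.starProjection_eq_self_iff.2 hv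

theorem tangentProj_tangentProj (ψ : SphereImmersion n p M) (x : M)
    (v : EuclideanSpace ℝ (Fin (n + p + 1))) :
    ψ.tangentProj x (ψ.tangentProj x v) = ψ.tangentProj x v :=
  ψ.tangentProj_apply_eq_self (ψ.tangentProj_mem x v)

theorem normalProj_normalProj (ψ : SphereImmersion n p M) (x : M)
    (v : EuclideanSpace ℝ (Fin (n + p + 1))) :
    ψ.normalProj x (ψ.normalProj x v) = ψ.normalProj x v :=
  ψ.normalProj_apply_eq_self (ψ.normalProj_mem x v)

theorem normalProj_of_mem_tangent (ψ : SphereImmersion n p M) {x : M}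
    {v : EuclideanSpace ℝ (Fin (n + p + 1))} (hv : v ∈ ψ.tangent x) : ψ.normalProj x v = 0 := by
  rw [normalProj, Submodule.starProjection_apply_eq_zero_iff, normal]
  exact Submodule.le_orthogonal_orthogonal _ (Submodule.mem_sup_left hv)

theorem normalProj_tangentProj (ψ : SphereImmersion n p M) (x : M)
    (v : EuclideanSpace ℝ (Fin (n + p + 1))) : ψ.normalProj x (ψ.tangentProj x v) = 0 :=
  ψ.normalProj_of_mem_tangent (ψ.tangentProj_mem x v)

theorem normalProj_pos (ψ : SphereImmersion n p M) (x : M) : ψ.normalProj x (ψ.pos x) = 0 := by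
  rw [normalProj, Submodule.starProjection_apply_eq_zero_iff, normal]
  exact Submodule.le_orthogonal_orthogonal _
    (Submodule.mem_sup_right (Submodule.mem_span_singleton_self _))

/-- The derivative of the tangential projection. -/
def dProj (ψ : SphereImmersion n p M) (x : M) (u : EuclideanSpace ℝ (Fin (n + p + 1))) :
    EuclideanSpace ℝ (Fin (n + p + 1)) →L[ℝ] EuclideanSpace ℝ (Fin (n + p + 1)) :=
  ψ.tangentialDeriv ψ.tangentProj x u

/-- The second derivative of the tangential projection. -/
def ddProj (ψ : SphereImmersion n p M) (x : M) (u v : EuclideanSpace ℝ (Fin (n + p + 1))) :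
    EuclideanSpace ℝ (Fin (n + p + 1)) →L[ℝ] EuclideanSpace ℝ (Fin (n + p + 1)) :=
  ψ.tangentialDeriv (fun y => ψ.dProj y v) x u

theorem dProj_tangentProj (ψ : SphereImmersion n p M) (x : M)
    (u : EuclideanSpace ℝ (Fin (n + p + 1))) : ψ.dProj x (ψ.tangentProj x u) = ψ.dProj x u :=
  ψ.tangentialDeriv_tangentProj _ x u

theorem dProj_zero (ψ : SphereImmersion n p M) (x : M) : ψ.dProj x 0 = 0 :=
  ψ.tangentialDeriv_zero_right _ x

variable [IsManifold (𝓡 n) ∞ M]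

theorem inner_pos_tangentProj (ψ : SphereImmersion n p M) (x : M)
    (v : EuclideanSpace ℝ (Fin (n + p + 1))) : ⟪ψ.pos x, ψ.tangentProj x v⟫ = 0 := by
  have h := ψ.tangentialDeriv_inner ψ.contMDiff_pos ψ.contMDiff_pos x v
  have h1 : (fun y => ⟪ψ.pos y, ψ.pos y⟫) = fun _ => (1 : ℝ) := by
    funext y
    rw [real_inner_self_eq_norm_sq, norm_pos, one_pow]
  rw [h1, tangentialDeriv_const, tangentialDeriv_pos, real_inner_comm] at h
  linarith

theorem tangentProj_pos (ψ : SphereImmersion n p M) (x : M) : ψ.tangentProj x (ψ.pos x) = 0 := by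
  rw [← inner_self_eq_zero (𝕜 := ℝ), inner_tangentProj, tangentProj_tangentProj,
    inner_pos_tangentProj]

theorem normalProj_apply (ψ : SphereImmersion n p M) (x : M)
    (v : EuclideanSpace ℝ (Fin (n + p + 1))) :
    ψ.normalProj x v = v - ψ.tangentProj x v - ⟪ψ.pos x, v⟫ • ψ.pos x := by
  refine Submodule.eq_starProjection_of_mem_orthogonal ?_ ?_
  · rw [normal, ← Submodule.inf_orthogonal, Submodule.mem_inf, Submodule.mem_orthogonal,
      Submodule.mem_orthogonal_singleton_iff_inner_right]
    constructor
    · intro w hw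
      rw [inner_sub_right, inner_sub_right, inner_smul_right, ← ψ.tangentProj_apply_eq_self hw,
        inner_tangentProj, inner_tangentProj, inner_tangentProj, tangentProj_tangentProj,
        tangentProj_pos, inner_zero_right]
      simp
    · rw [inner_sub_right, inner_sub_right, inner_smul_right, inner_pos_tangentProj,
        real_inner_self_eq_norm_sq, norm_pos]
      simp
  · refine Submodule.le_orthogonal_orthogonal _ ?_
    have : v - (v - ψ.tangentProj x v - ⟪ψ.pos x, v⟫ • ψ.pos x) =
        ψ.tangentProj x v + ⟪ψ.pos x, v⟫ • ψ.pos x := by abel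
    rw [this]
    exact add_mem (Submodule.mem_sup_left (ψ.tangentProj_mem x v))
      (Submodule.mem_sup_right (Submodule.smul_mem _ _ (Submodule.mem_span_singleton_self _)))

theorem eq_add_normalProj (ψ : SphereImmersion n p M) (x : M)
    (v : EuclideanSpace ℝ (Fin (n + p + 1))) :
    v = ψ.tangentProj x v + ψ.normalProj x v + ⟪ψ.pos x, v⟫ • ψ.pos x := by
  rw [normalProj_apply]
  abel

theorem contMDiff_normalProj (ψ : SphereImmersion n p M) :
    ContMDiff (𝓡 n) 𝓘(ℝ, EuclideanSpace ℝ (Fin (n + p + 1)) →L[ℝ]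
      EuclideanSpace ℝ (Fin (n + p + 1))) ∞ ψ.normalProj := by
  have h : ψ.normalProj = fun x => ContinuousLinearMap.id ℝ _ - ψ.tangentProj x -
      (ContinuousLinearMap.smulRightL ℝ _ _ (innerSL ℝ (ψ.pos x))) (ψ.pos x) := by
    funext x
    ext1 v
    rw [normalProj_apply]
    rfl
  rw [h]
  refine (contMDiff_const.sub ψ.contMDiff_tangentProj).sub (ContMDiff.clm_apply ?_ ψ.contMDiff_pos)
  exact (ContinuousLinearMap.contMDiff _).comp
    ((ContinuousLinearMap.contMDiff (innerSL ℝ)).comp ψ.contMDiff_pos)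

theorem contMDiff_dProj (ψ : SphereImmersion n p M) (u : EuclideanSpace ℝ (Fin (n + p + 1))) :
    ContMDiff (𝓡 n) 𝓘(ℝ, EuclideanSpace ℝ (Fin (n + p + 1)) →L[ℝ]
      EuclideanSpace ℝ (Fin (n + p + 1))) ∞ (fun x => ψ.dProj x u) :=
  ψ.contMDiff_tangentialDeriv ψ.contMDiff_tangentProj u

theorem tangentialDeriv_tangentProj_apply (ψ : SphereImmersion n p M)
    {g : M → EuclideanSpace ℝ (Fin (n + p + 1))}
    (hg : ContMDiff (𝓡 n) 𝓘(ℝ, EuclideanSpace ℝ (Fin (n + p + 1))) ∞ g) (x : M)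
    (u : EuclideanSpace ℝ (Fin (n + p + 1))) :
    ψ.tangentialDeriv (fun y => ψ.tangentProj y (g y)) x u =
      ψ.dProj x u (g x) + ψ.tangentProj x (ψ.tangentialDeriv g x u) :=
  ψ.tangentialDeriv_clm_apply ψ.contMDiff_tangentProj hg x u

theorem tangentialDeriv_dProj_apply (ψ : SphereImmersion n p M)
    {g : M → EuclideanSpace ℝ (Fin (n + p + 1))}
    (hg : ContMDiff (𝓡 n) 𝓘(ℝ, EuclideanSpace ℝ (Fin (n + p + 1))) ∞ g) (x : M)
    (u v : EuclideanSpace ℝ (Fin (n + p + 1))) :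
    ψ.tangentialDeriv (fun y => ψ.dProj y v (g y)) x u =
      ψ.ddProj x u v (g x) + ψ.dProj x v (ψ.tangentialDeriv g x u) :=
  ψ.tangentialDeriv_clm_apply (ψ.contMDiff_dProj v) hg x u

theorem tangentialDeriv_tangentProj_apply_const (ψ : SphereImmersion n p M) (x : M)
    (u w : EuclideanSpace ℝ (Fin (n + p + 1))) :
    ψ.tangentialDeriv (fun y => ψ.tangentProj y w) x u = ψ.dProj x u w :=
  ψ.tangentialDeriv_clm_apply_const ψ.contMDiff_tangentProj w x u

theorem tangentialDeriv_dProj_apply_const (ψ : SphereImmersion n p M) (x : M)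
    (u v w : EuclideanSpace ℝ (Fin (n + p + 1))) :
    ψ.tangentialDeriv (fun y => ψ.dProj y v w) x u = ψ.ddProj x u v w :=
  ψ.tangentialDeriv_clm_apply_const (ψ.contMDiff_dProj v) w x u

theorem contMDiff_tangentProj_apply (ψ : SphereImmersion n p M)
    (w : EuclideanSpace ℝ (Fin (n + p + 1))) :
    ContMDiff (𝓡 n) 𝓘(ℝ, EuclideanSpace ℝ (Fin (n + p + 1))) ∞ (fun y => ψ.tangentProj y w) :=
  ψ.contMDiff_tangentProj.clm_apply contMDiff_const

theorem contMDiff_normalProj_apply (ψ : SphereImmersion n p M)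
    (w : EuclideanSpace ℝ (Fin (n + p + 1))) :
    ContMDiff (𝓡 n) 𝓘(ℝ, EuclideanSpace ℝ (Fin (n + p + 1))) ∞ (fun y => ψ.normalProj y w) :=
  ψ.contMDiff_normalProj.clm_apply contMDiff_const

theorem contMDiff_dProj_apply (ψ : SphereImmersion n p M)
    (v w : EuclideanSpace ℝ (Fin (n + p + 1))) :
    ContMDiff (𝓡 n) 𝓘(ℝ, EuclideanSpace ℝ (Fin (n + p + 1))) ∞ (fun y => ψ.dProj y v w) :=
  (ψ.contMDiff_dProj v).clm_apply contMDiff_const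

/-- The derivative of `P ∘ P = P`. -/
theorem dProj_eq_add (ψ : SphereImmersion n p M) (x : M)
    (u w : EuclideanSpace ℝ (Fin (n + p + 1))) :
    ψ.dProj x u w = ψ.dProj x u (ψ.tangentProj x w) + ψ.tangentProj x (ψ.dProj x u w) := by
  have h := ψ.tangentialDeriv_tangentProj_apply (ψ.contMDiff_tangentProj_apply w) x u
  simp only [tangentProj_tangentProj, tangentialDeriv_tangentProj_apply_const] at h
  exact h

theorem normalProj_dProj (ψ : SphereImmersion n p M) (x : M)
    (u w : EuclideanSpace ℝ (Fin (n + p + 1))) :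
    ψ.normalProj x (ψ.dProj x u (ψ.tangentProj x w)) = ψ.normalProj x (ψ.dProj x u w) := by
  conv_rhs => rw [dProj_eq_add, map_add, normalProj_tangentProj, add_zero]

/-- Differentiating `P ∘ P = P` gives `P P' P = 0`. Geometrically, the tangential part of a vector
tangent at `x` is a field parallel at `x`. -/
theorem tangentProj_dProj_tangentProj (ψ : SphereImmersion n p M) (x : M)
    (u w : EuclideanSpace ℝ (Fin (n + p + 1))) :
    ψ.tangentProj x (ψ.dProj x u (ψ.tangentProj x w)) = 0 := by
  have h := ψ.dProj_eq_add x u (ψ.tangentProj x w)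
  rw [tangentProj_tangentProj] at h
  exact left_eq_add.1 h

/-- This is the derivative of `P ψ = 0`; it carries the curvature of the sphere. -/
theorem dProj_pos (ψ : SphereImmersion n p M) (x : M) (u : EuclideanSpace ℝ (Fin (n + p + 1))) :
    ψ.dProj x u (ψ.pos x) = -ψ.tangentProj x u := by
  have h := ψ.tangentialDeriv_tangentProj_apply ψ.contMDiff_pos x u
  simp only [tangentProj_pos, tangentialDeriv_pos, tangentialDeriv_const,
    tangentProj_tangentProj] at h
  exact eq_neg_of_add_eq_zero_left h.symm

theorem inner_dProj (ψ : SphereImmersion n p M) (x : M)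
    (u v w : EuclideanSpace ℝ (Fin (n + p + 1))) :
    ⟪ψ.dProj x u v, w⟫ = ⟪v, ψ.dProj x u w⟫ := by
  have h1 := ψ.tangentialDeriv_inner (ψ.contMDiff_tangentProj_apply v)
    (contMDiff_const (c := w)) x u
  have h2 := ψ.tangentialDeriv_inner (contMDiff_const (c := v))
    (ψ.contMDiff_tangentProj_apply w) x u
  simp only [inner_tangentProj] at h1
  rw [h2] at h1
  simpa [tangentialDeriv_const, tangentialDeriv_tangentProj_apply_const] using h1.symm

theorem tangentialDeriv_normalProj_apply_const (ψ : SphereImmersion n p M) (x : M)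
    (u w : EuclideanSpace ℝ (Fin (n + p + 1))) :
    ψ.tangentialDeriv (fun y => ψ.normalProj y w) x u =
      -ψ.dProj x u w - (⟪ψ.tangentProj x u, w⟫ • ψ.pos x + ⟪ψ.pos x, w⟫ • ψ.tangentProj x u) := by
  have hi := ψ.contMDiff_pos.inner_euclidean (contMDiff_const (c := w))
  have hs : ContMDiff (𝓡 n) 𝓘(ℝ, EuclideanSpace ℝ (Fin (n + p + 1))) ∞
      (fun y => ⟪ψ.pos y, w⟫ • ψ.pos y) := hi.smul ψ.contMDiff_pos
  simp only [normalProj_apply]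
  rw [ψ.tangentialDeriv_sub (contMDiff_const.sub (ψ.contMDiff_tangentProj_apply w))
    hs, ψ.tangentialDeriv_sub contMDiff_const
    (ψ.contMDiff_tangentProj_apply w), ψ.tangentialDeriv_smul hi ψ.contMDiff_pos,
    ψ.tangentialDeriv_inner ψ.contMDiff_pos contMDiff_const]
  simp [tangentialDeriv_const, tangentialDeriv_tangentProj_apply_const, tangentialDeriv_pos]

/-- The normal derivative of the normal projection. -/
theorem normalProj_tangentialDeriv_normalProj_apply (ψ : SphereImmersion n p M)
    {g : M → EuclideanSpace ℝ (Fin (n + p + 1))}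
    (hg : ContMDiff (𝓡 n) 𝓘(ℝ, EuclideanSpace ℝ (Fin (n + p + 1))) ∞ g) (x : M)
    (u : EuclideanSpace ℝ (Fin (n + p + 1))) :
    ψ.normalProj x (ψ.tangentialDeriv (fun y => ψ.normalProj y (g y)) x u) =
      ψ.normalProj x (ψ.tangentialDeriv g x u) - ψ.normalProj x (ψ.dProj x u (g x)) := by
  rw [ψ.tangentialDeriv_clm_apply ψ.contMDiff_normalProj hg,
    ← ψ.tangentialDeriv_clm_apply_const ψ.contMDiff_normalProj,
    tangentialDeriv_normalProj_apply_const]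
  simp only [map_add, map_sub, map_neg, map_smul, normalProj_pos, normalProj_tangentProj,
    normalProj_normalProj, smul_zero, add_zero, sub_zero]
  abel

theorem normalProj_tangentialDeriv_normalProj (ψ : SphereImmersion n p M) (x : M)
    (u a : EuclideanSpace ℝ (Fin (n + p + 1))) :
    ψ.normalProj x (ψ.tangentialDeriv (fun y => ψ.normalProj y a) x u) =
      -ψ.normalProj x (ψ.dProj x u a) := by
  rw [ψ.normalProj_tangentialDeriv_normalProj_apply contMDiff_const, tangentialDeriv_const,
    map_zero, zero_sub]

/-- The symmetry of the second fundamental form. -/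
theorem normalProj_dProj_comm (ψ : SphereImmersion n p M) (x : M)
    (v w : EuclideanSpace ℝ (Fin (n + p + 1))) :
    ψ.normalProj x (ψ.dProj x v w) = ψ.normalProj x (ψ.dProj x w v) := by
  have h : ψ.normalProj x (ψ.projBracket x v w) = 0 := by
    rw [← tangentProj_projBracket, normalProj_tangentProj]
  rw [projBracket, map_sub] at h
  exact sub_eq_zero.1 h

/-- Differentiating `P' = P' P + P P'` once more and applying `N` separates the part of `P''` that
plays the role of `∇II` from the terms quadratic in `P'`. -/
theorem normalProj_ddProj (ψ : SphereImmersion n p M) (x : M)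
    (u v w : EuclideanSpace ℝ (Fin (n + p + 1))) :
    ψ.normalProj x (ψ.ddProj x u v w) = ψ.normalProj x (ψ.ddProj x u v (ψ.tangentProj x w)) +
      ψ.normalProj x (ψ.dProj x v (ψ.dProj x u w)) +
      ψ.normalProj x (ψ.dProj x u (ψ.dProj x v w)) := by
  have h1 := ψ.tangentialDeriv_add ((ψ.contMDiff_dProj v).clm_apply
    (ψ.contMDiff_tangentProj_apply w)) (ψ.contMDiff_tangentProj.clm_apply
    (ψ.contMDiff_dProj_apply v w)) x u
  simp only [← dProj_eq_add] at h1
  rw [tangentialDeriv_dProj_apply_const,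
    ψ.tangentialDeriv_dProj_apply (ψ.contMDiff_tangentProj_apply w),
    ψ.tangentialDeriv_tangentProj_apply (ψ.contMDiff_dProj_apply v w),
    tangentialDeriv_dProj_apply_const, tangentialDeriv_tangentProj_apply_const] at h1
  conv_lhs => rw [h1]
  simp only [map_add, normalProj_tangentProj]
  abel

/-- The bracket is tangent, while `P P' P = 0` removes the tangential part of each of its two terms.
-/
theorem projBracket_of_mem_tangent (ψ : SphereImmersion n p M) {x : M}
    {v w : EuclideanSpace ℝ (Fin (n + p + 1))} (hv : v ∈ ψ.tangent x) (hw : w ∈ ψ.tangent x) :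
    ψ.projBracket x v w = 0 := by
  rw [← tangentProj_projBracket, projBracket]
  have h1 := ψ.tangentProj_dProj_tangentProj x v w
  have h2 := ψ.tangentProj_dProj_tangentProj x w v
  rw [ψ.tangentProj_apply_eq_self hw] at h1
  rw [ψ.tangentProj_apply_eq_self hv] at h2
  refine (map_sub (ψ.tangentProj x) (ψ.dProj x v w) (ψ.dProj x w v)).trans ?_
  rw [h1, h2, sub_zero]

theorem ddProj_comm (ψ : SphereImmersion n p M) (x : M)
    (u v : EuclideanSpace ℝ (Fin (n + p + 1))) :
    ψ.ddProj x u v - ψ.ddProj x v u = ψ.dProj x (ψ.projBracket x u v) :=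
  ψ.tangentialDeriv_comm ψ.contMDiff_tangentProj x u v

/-- The Codazzi equation. -/
theorem normalProj_ddProj_swap (ψ : SphereImmersion n p M) {x : M}
    (u : EuclideanSpace ℝ (Fin (n + p + 1)))
    {v w : EuclideanSpace ℝ (Fin (n + p + 1))} (hv : v ∈ ψ.tangent x) (hw : w ∈ ψ.tangent x) :
    ψ.normalProj x (ψ.ddProj x u v w) = ψ.normalProj x (ψ.ddProj x u w v) := by
  -- For constant `v`, `w` the normal part of `P'_v w - P'_w v` vanishes at every point, hence so
  -- does its derivative. The correction from differentiating `N` vanishes too, since this bracket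
  -- is zero at `x`.
  have h := ψ.normalProj_tangentialDeriv_normalProj_apply
    ((ψ.contMDiff_dProj_apply v w).sub (ψ.contMDiff_dProj_apply w v)) x u
  simp only [map_sub (ψ.normalProj _) (ψ.dProj _ v w), ψ.normalProj_dProj_comm _ v w, sub_self,
    tangentialDeriv_const, map_zero] at h
  rw [ψ.tangentialDeriv_sub (ψ.contMDiff_dProj_apply v w) (ψ.contMDiff_dProj_apply w v),
    tangentialDeriv_dProj_apply_const, tangentialDeriv_dProj_apply_const,
    show ψ.dProj x v w - ψ.dProj x w v = 0 from ψ.projBracket_of_mem_tangent hv hw,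
    map_zero, map_zero, sub_zero, map_sub] at h
  exact sub_eq_zero.1 h.symm

theorem ddProj_swap (ψ : SphereImmersion n p M) {x : M}
    {u v : EuclideanSpace ℝ (Fin (n + p + 1))} (hu : u ∈ ψ.tangent x) (hv : v ∈ ψ.tangent x) :
    ψ.ddProj x u v = ψ.ddProj x v u := by
  have h := ψ.ddProj_comm x u v
  rw [ψ.projBracket_of_mem_tangent hu hv, dProj_zero] at h
  exact sub_eq_zero.1 h

end SphereImmersion


/-! ### Traces, minimality, and the Jacobi operator on normal parts of constant vectors -/

/-- The trace of a bilinear map over a subspace, computed from an orthonormal basis of the ambient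
space. -/
theorem sum_apply_starProjection {ι κ F G : Type*} [Fintype ι] [Fintype κ] [NormedAddCommGroup F]
    [InnerProductSpace ℝ F] [AddCommGroup G] [Module ℝ G] (K : Submodule ℝ F)
    [K.HasOrthogonalProjection] (e : OrthonormalBasis κ ℝ K) (ε : OrthonormalBasis ι ℝ F)
    (b : F →ₗ[ℝ] F →ₗ[ℝ] G) :
    ∑ α, b (ε α) (K.starProjection (ε α)) = ∑ i, b (e i) (e i) := by
  have h : ∀ v, K.starProjection v = ∑ i, ⟪(e i : F), v⟫ • (e i : F) := fun v => by
    rw [Submodule.starProjection_apply, e.orthogonalProjectionOnto_apply_eq_sum]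
    simp
  simp only [h, map_sum, map_smul]
  rw [Finset.sum_comm]
  refine Finset.sum_congr rfl fun i _ => ?_
  have hb : b (e i : F) = ∑ α, ⟪ε α, (e i : F)⟫ • b (ε α) := by
    conv_lhs => rw [← ε.sum_repr' (e i : F)]
    simp
  simp [hb, real_inner_comm]

theorem sum_starProjection_apply {ι κ F G : Type*} [Fintype ι] [Fintype κ] [NormedAddCommGroup F]
    [InnerProductSpace ℝ F] [AddCommGroup G] [Module ℝ G] (K : Submodule ℝ F)
    [K.HasOrthogonalProjection] (e : OrthonormalBasis κ ℝ K) (ε : OrthonormalBasis ι ℝ F)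
    (b : F →ₗ[ℝ] F →ₗ[ℝ] G) :
    ∑ α, b (K.starProjection (ε α)) (ε α) = ∑ i, b (e i) (e i) :=
  sum_apply_starProjection K e ε b.flip

namespace SphereImmersion

variable {n p : ℕ} {M : Type*} [TopologicalSpace M]
  [ChartedSpace (EuclideanSpace ℝ (Fin n)) M]

theorem dpos_mem_tangent (ψ : SphereImmersion n p M) (x : M) (u : TangentSpace (𝓡 n) x) :
    ψ.dpos x u ∈ ψ.tangent x :=
  ⟨u, rfl⟩

theorem dpos_frame (ψ : SphereImmersion n p M) (x : M)
    (i : Fin (Module.finrank ℝ (ψ.tangent x))) :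
    ψ.dpos x (ψ.frame x i) = (stdOrthonormalBasis ℝ (ψ.tangent x) i : _) :=
  congrArg Subtype.val
    ((ψ.tangentEquiv x).apply_symm_apply (stdOrthonormalBasis ℝ (ψ.tangent x) i))

theorem tangentProj_eq_sum_frame (ψ : SphereImmersion n p M) (x : M)
    (v : EuclideanSpace ℝ (Fin (n + p + 1))) :
    ψ.tangentProj x v = ∑ j, ⟪ψ.dpos x (ψ.frame x j), v⟫ • ψ.dpos x (ψ.frame x j) := by
  rw [tangentProj, Submodule.starProjection_apply,
    (stdOrthonormalBasis ℝ (ψ.tangent x)).orthogonalProjectionOnto_apply_eq_sum]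
  simp [dpos_frame]

theorem mfderiv_apply_eq_tangentialDeriv {G : Type*} [NormedAddCommGroup G] [NormedSpace ℝ G]
    (ψ : SphereImmersion n p M) (g : M → G) (x : M) (u : TangentSpace (𝓡 n) x) :
    mfderiv (𝓡 n) 𝓘(ℝ, G) g x u = ψ.tangentialDeriv g x (ψ.dpos x u) := by
  rw [tangentialDeriv, tangentialPart_dpos]

/-- The bilinear form `(v, w) ↦ N (P'_v (L w))`. -/
def dProjForm (ψ : SphereImmersion n p M) (x : M)
    (L : EuclideanSpace ℝ (Fin (n + p + 1)) →L[ℝ] EuclideanSpace ℝ (Fin (n + p + 1))) :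
    EuclideanSpace ℝ (Fin (n + p + 1)) →ₗ[ℝ] EuclideanSpace ℝ (Fin (n + p + 1)) →ₗ[ℝ]
      EuclideanSpace ℝ (Fin (n + p + 1)) :=
  LinearMap.mk₂ ℝ (fun v w => ψ.normalProj x (ψ.dProj x v (L w)))
    (fun u v w => by simp [dProj, tangentialDeriv_add_right])
    (fun r u w => by simp [dProj, tangentialDeriv_smul_right])
    (fun u v w => by simp) (fun r u w => by simp)

/-- The frame is chosen separately at each point and cannot be differentiated. The trace is
therefore moved to a fixed basis of the ambient space; this is possible because `P'_v` depends only
on `P v`. -/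
theorem sum_dProj_frame (ψ : SphereImmersion n p M) (x : M)
    (L : EuclideanSpace ℝ (Fin (n + p + 1)) →L[ℝ] EuclideanSpace ℝ (Fin (n + p + 1))) :
    ∑ α, ψ.normalProj x (ψ.dProj x (EuclideanSpace.basisFun (Fin (n + p + 1)) ℝ α)
      (L (EuclideanSpace.basisFun (Fin (n + p + 1)) ℝ α))) =
    ∑ i, ψ.normalProj x (ψ.dProj x (ψ.dpos x (ψ.frame x i)) (L (ψ.dpos x (ψ.frame x i)))) := by
  have h := sum_starProjection_apply (ψ.tangent x) (stdOrthonormalBasis ℝ (ψ.tangent x))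
    (EuclideanSpace.basisFun (Fin (n + p + 1)) ℝ) (ψ.dProjForm x L)
  have h1 : ∀ v w, ψ.dProjForm x L ((ψ.tangent x).starProjection v) w =
      ψ.normalProj x (ψ.dProj x v (L w)) := fun v w =>
    congrArg (fun A => ψ.normalProj x (A (L w))) (ψ.dProj_tangentProj x v)
  simp only [h1] at h
  rw [h]
  simp only [dpos_frame]
  rfl

variable [IsManifold (𝓡 n) ∞ M]

theorem ambientDeriv_extend (ψ : SphereImmersion n p M) (x : M) (u w : TangentSpace (𝓡 n) x) :
    ψ.ambientDeriv (fun y => ψ.dpos y (ψ.extend x w y)) x u =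
      ψ.dProj x (ψ.dpos x u) (ψ.dpos x w) := by
  simp only [extend, dpos_tangentialPart]
  rw [ambientDeriv, ψ.mfderiv_apply_eq_tangentialDeriv, tangentialDeriv_tangentProj_apply_const]

theorem secondFundamentalForm_eq (ψ : SphereImmersion n p M) (x : M)
    (u w : TangentSpace (𝓡 n) x) :
    ψ.secondFundamentalForm x u w = ψ.normalProj x (ψ.dProj x (ψ.dpos x u) (ψ.dpos x w)) := by
  rw [secondFundamentalForm, ambientDeriv_extend]
  rfl

theorem leviCivita_extend (ψ : SphereImmersion n p M) (x : M) (u w : TangentSpace (𝓡 n) x) :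
    ψ.leviCivita (ψ.extend x w) x u = 0 := by
  rw [leviCivita, ambientDeriv_extend]
  have h := ψ.tangentProj_dProj_tangentProj x (ψ.dpos x u) (ψ.dpos x w)
  rw [ψ.tangentProj_apply_eq_self (ψ.dpos_mem_tangent x w)] at h
  rw [← tangentialPart_tangentProj, h]
  simp [tangentialPart]

theorem normalHessian_eq (ψ : SphereImmersion n p M) (V : M → EuclideanSpace ℝ (Fin (n + p + 1)))
    (x : M) (u w : TangentSpace (𝓡 n) x) :
    ψ.normalHessian V x u w = ψ.normalProj x (ψ.tangentialDeriv
      (fun y => ψ.normalProj y (ψ.tangentialDeriv V y (ψ.dpos x w))) x (ψ.dpos x u)) := by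
  rw [normalHessian, leviCivita_extend]
  have h : ψ.normalConnection V x 0 = 0 := by
    rw [normalConnection, ambientDeriv, map_zero]
    exact map_zero (ψ.normalProj x)
  rw [h, sub_zero, ← mfderiv_apply_eq_tangentialDeriv]
  rfl

/-- In dimension zero `IsMinimal` carries no information and `-n` is not negative, so this case has
to be excluded. -/
theorem IsTotallyGeodesic.of_dim_eq_zero {ψ : SphereImmersion n p M} (hn : n = 0) :
    ψ.IsTotallyGeodesic := by
  subst hn
  intro x u w
  have : u = 0 := Subsingleton.elim (α := EuclideanSpace ℝ (Fin 0)) u 0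
  rw [secondFundamentalForm_eq, this, map_zero, dProj_zero]
  simp

theorem tangentialDeriv_sum {ι G : Type*} [NormedAddCommGroup G] [NormedSpace ℝ G]
    (ψ : SphereImmersion n p M) (s : Finset ι) {g : ι → M → G}
    (hg : ∀ i, ContMDiff (𝓡 n) 𝓘(ℝ, G) ∞ (g i)) (x : M)
    (u : EuclideanSpace ℝ (Fin (n + p + 1))) :
    ψ.tangentialDeriv (fun y => ∑ i ∈ s, g i y) x u = ∑ i ∈ s, ψ.tangentialDeriv (g i) x u := by
  classical
  induction s using Finset.induction_on with
  | empty => simp [tangentialDeriv_const]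
  | insert i s hi ih =>
    simp only [Finset.sum_insert hi]
    rw [ψ.tangentialDeriv_add (hg i) (contMDiff_finsetSum fun j _ => hg j), ih]

theorem ddProj_add_right (ψ : SphereImmersion n p M) (x : M)
    (t u v : EuclideanSpace ℝ (Fin (n + p + 1))) :
    ψ.ddProj x t (u + v) = ψ.ddProj x t u + ψ.ddProj x t v := by
  rw [ddProj, ddProj, ddProj,
    ← ψ.tangentialDeriv_add (ψ.contMDiff_dProj u) (ψ.contMDiff_dProj v)]
  simp only [dProj, tangentialDeriv_add_right]

theorem ddProj_smul_right (ψ : SphereImmersion n p M) (x : M) (r : ℝ)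
    (t u : EuclideanSpace ℝ (Fin (n + p + 1))) :
    ψ.ddProj x t (r • u) = r • ψ.ddProj x t u := by
  have h := ψ.tangentialDeriv_clm_comp (r • ContinuousLinearMap.id ℝ _) (ψ.contMDiff_dProj u) x t
  have h' : (fun y => ψ.dProj y (r • u)) =
      fun y => (r • ContinuousLinearMap.id ℝ _) (ψ.dProj y u) :=
    funext fun y => ψ.tangentialDeriv_smul_right _ y r u
  rw [ddProj, h', h]
  rfl

theorem IsMinimal.sum_normalProj_dProj {ψ : SphereImmersion n p M} (hmin : ψ.IsMinimal)
    (hn : n ≠ 0) (x : M) :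
    ∑ i, ψ.normalProj x (ψ.dProj x (ψ.dpos x (ψ.frame x i)) (ψ.dpos x (ψ.frame x i))) = 0 := by
  have h := hmin x
  rw [meanCurvature, smul_eq_zero_iff_right (by simpa using hn)] at h
  simpa only [secondFundamentalForm_eq] using h

/-- The bilinear form `(v, w) ↦ N (P''_{t,v} w)`. -/
def ddProjForm (ψ : SphereImmersion n p M) (x : M) (t : EuclideanSpace ℝ (Fin (n + p + 1))) :
    EuclideanSpace ℝ (Fin (n + p + 1)) →ₗ[ℝ] EuclideanSpace ℝ (Fin (n + p + 1)) →ₗ[ℝ]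
      EuclideanSpace ℝ (Fin (n + p + 1)) :=
  LinearMap.mk₂ ℝ (fun v w => ψ.normalProj x (ψ.ddProj x t v w))
    (fun u v w => by simp [ddProj_add_right])
    (fun r u w => by simp [ddProj_smul_right])
    (fun u v w => by simp) (fun r u w => by simp)

/-- The derivative of the mean curvature of a minimal immersion vanishes. -/
theorem IsMinimal.sum_normalProj_ddProj {ψ : SphereImmersion n p M} (hmin : ψ.IsMinimal)
    (hn : n ≠ 0) (x : M) (t : EuclideanSpace ℝ (Fin (n + p + 1))) :
    ∑ i, ψ.normalProj x (ψ.ddProj x t (ψ.dpos x (ψ.frame x i)) (ψ.dpos x (ψ.frame x i))) = 0 := by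
  set ε := EuclideanSpace.basisFun (Fin (n + p + 1)) ℝ with hε
  have hs : ∀ α, ContMDiff (𝓡 n) 𝓘(ℝ, EuclideanSpace ℝ (Fin (n + p + 1))) ∞
    (fun y => ψ.dProj y (ε α) (ε α)) := fun α => ψ.contMDiff_dProj_apply _ _
  have h0 : ∀ y, ψ.normalProj y (∑ α, ψ.dProj y (ε α) (ε α)) = 0 := fun y => by
    have h := ψ.sum_dProj_frame y (ContinuousLinearMap.id ℝ _)
    simp only [ContinuousLinearMap.id_apply] at h
    rw [map_sum, h, hmin.sum_normalProj_dProj hn]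
  have h1 := ψ.normalProj_tangentialDeriv_normalProj_apply
    (contMDiff_finsetSum (t := Finset.univ) fun α _ => hs α) x t
  simp only [h0, tangentialDeriv_const, ψ.tangentialDeriv_sum _ hs,
    tangentialDeriv_dProj_apply_const, map_sum, map_zero] at h1
  rw [Finset.sum_congr rfl fun α _ => ψ.normalProj_ddProj x t (ε α) (ε α),
    Finset.sum_add_distrib, Finset.sum_add_distrib] at h1
  -- The last sum in the expansion of `N P''` is exactly the correction from differentiating `N`, so
  -- the two cancel.
  rw [add_sub_cancel_right, ψ.sum_dProj_frame x (ψ.dProj x t)] at h1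
  -- `N P'` sees only the tangential part of its argument, and that part of `P'_t e_i` is zero by `P
  -- P' P = 0`.
  have h2 : ∑ i, ψ.normalProj x (ψ.dProj x (ψ.dpos x (ψ.frame x i))
      (ψ.dProj x t (ψ.dpos x (ψ.frame x i)))) = 0 := by
    refine Finset.sum_eq_zero fun i _ => ?_
    have h3 := ψ.tangentProj_dProj_tangentProj x t (ψ.dpos x (ψ.frame x i))
    rw [ψ.tangentProj_apply_eq_self (ψ.dpos_mem_tangent _ _)] at h3
    rw [← normalProj_dProj, h3, map_zero, map_zero]
  have h4 := sum_apply_starProjection (ψ.tangent x) (stdOrthonormalBasis ℝ (ψ.tangent x)) ε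
    (ψ.ddProjForm x t)
  rw [h2, add_zero] at h1
  simp only [dpos_frame]
  exact h4.symm.trans h1.symm

/-- The section of the normal bundle given by the normal part of a constant vector. -/
def constNormal (ψ : SphereImmersion n p M) :
    EuclideanSpace ℝ (Fin (n + p + 1)) →ₗ[ℝ] ψ.normalSections where
  toFun a := ⟨fun x => ψ.normalProj x a,
    ψ.contMDiff_normalProj_apply a, fun x => ψ.normalProj_mem x a⟩
  map_add' a b := by ext1; funext x; exact map_add (ψ.normalProj x) a b
  map_smul' r a := by ext1; funext x; exact map_smul (ψ.normalProj x) r a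

/-- The first normal derivative of `a^⊥` is `-N P'_c a`; the second follows by splitting `a` into
its tangential, normal and position parts. Each of the three terms has a trace that is known for a
minimal immersion. -/
theorem normalHessian_constNormal (ψ : SphereImmersion n p M)
    (a : EuclideanSpace ℝ (Fin (n + p + 1))) (x : M) (u : TangentSpace (𝓡 n) x) :
    ψ.normalHessian (ψ.constNormal a).1 x u u =
      ⟪ψ.pos x, a⟫ • ψ.normalProj x (ψ.dProj x (ψ.dpos x u) (ψ.dpos x u)) -
        ψ.normalProj x (ψ.ddProj x (ψ.tangentProj x a) (ψ.dpos x u) (ψ.dpos x u)) -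
        ψ.normalProj x (ψ.dProj x (ψ.dpos x u) (ψ.dProj x (ψ.dpos x u) (ψ.normalProj x a))) := by
  have hu := ψ.dpos_mem_tangent x u
  set c := ψ.dpos x u with hc
  have h1 : ψ.normalHessian (ψ.constNormal a).1 x u u =
      ψ.normalProj x (ψ.tangentialDeriv (fun y => ψ.normalProj y (-ψ.dProj y c a)) x c) := by
    rw [normalHessian_eq]
    simp only [constNormal, LinearMap.coe_mk, AddHom.coe_mk, map_neg,
      normalProj_tangentialDeriv_normalProj]
    rfl
  have h2 : ψ.tangentialDeriv (fun y => -ψ.dProj y c a) x c = -ψ.ddProj x c c a := by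
    have := ψ.tangentialDeriv_sub contMDiff_const (f := fun _ => 0)
      (ψ.contMDiff_dProj_apply c a) x c
    simpa [tangentialDeriv_const, tangentialDeriv_dProj_apply_const] using this
  -- Codazzi and the commutation of derivatives move `a^T` to the slot of the outer derivative, so
  -- that the trace over `c` becomes a derivative of the mean curvature.
  have h3 : ψ.normalProj x (ψ.ddProj x c c (ψ.tangentProj x a)) =
      ψ.normalProj x (ψ.ddProj x (ψ.tangentProj x a) c c) := by
    rw [ψ.normalProj_ddProj_swap c hu (ψ.tangentProj_mem x a),
      ψ.ddProj_swap hu (ψ.tangentProj_mem x a)]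
  have h4 : ψ.normalProj x (ψ.dProj x c (ψ.dProj x c a)) =
      ψ.normalProj x (ψ.dProj x c (ψ.dProj x c (ψ.normalProj x a))) -
        ⟪ψ.pos x, a⟫ • ψ.normalProj x (ψ.dProj x c c) := by
    conv_lhs => rw [ψ.eq_add_normalProj x a]
    simp only [map_add, map_smul, dProj_pos, ψ.tangentProj_apply_eq_self hu]
    rw [← ψ.normalProj_dProj x c (ψ.dProj x c (ψ.tangentProj x a)), tangentProj_dProj_tangentProj]
    simp [sub_eq_add_neg]
  rw [h1, ψ.normalProj_tangentialDeriv_normalProj_apply (ψ.contMDiff_dProj_apply c a).neg, h2,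
    map_neg, map_neg, map_neg, normalProj_ddProj, h3, h4]
  abel

/-- The normal part of a constant vector is an eigensection of the Jacobi operator. -/
theorem IsMinimal.jacobi_constNormal {ψ : SphereImmersion n p M} (hmin : ψ.IsMinimal)
    (hn : n ≠ 0) (a : EuclideanSpace ℝ (Fin (n + p + 1))) (x : M) :
    ψ.jacobi (ψ.constNormal a).1 x = (n : ℝ) • (ψ.constNormal a).1 x := by
  have h : ψ.normalLaplacian (ψ.constNormal a).1 x =
      -ψ.simonsOperator x ((ψ.constNormal a).1 x) := by
    simp only [normalLaplacian, normalHessian_constNormal, Finset.sum_sub_distrib,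
      ← Finset.smul_sum, hmin.sum_normalProj_ddProj hn, hmin.sum_normalProj_dProj hn, smul_zero,
      sub_zero, zero_sub, simonsOperator]
    congr 1
    refine Finset.sum_congr rfl fun i _ => ?_
    -- Only the tangential part of `P'_{e_i} a^⊥` contributes. As `P'` is self-adjoint, its
    -- coefficients in the frame are `⟨II(e_i, e_j), a^⊥⟩`.
    rw [← normalProj_dProj, tangentProj_eq_sum_frame, map_sum, map_sum]
    refine Finset.sum_congr rfl fun j _ => ?_
    rw [map_smul, map_smul, secondFundamentalForm_eq, ← inner_dProj, inner_normalProj]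
    congr 2
    exact (ψ.normalProj_normalProj x a).symm
  rw [jacobi, h]
  abel

end SphereImmersion


/-! ### Rigidity when a constant vector has no normal part -/

namespace SphereImmersion

variable {n p : ℕ} {M : Type*} [TopologicalSpace M]
  [ChartedSpace (EuclideanSpace ℝ (Fin n)) M] [IsManifold (𝓡 n) ∞ M]

theorem tangentialDeriv_eq_zero_of_isLocalExtr (ψ : SphereImmersion n p M) {g : M → ℝ}
    (hg : ContMDiff (𝓡 n) 𝓘(ℝ, ℝ) ∞ g) {x : M} (hx : IsLocalExtr g x)
    (u : EuclideanSpace ℝ (Fin (n + p + 1))) : ψ.tangentialDeriv g x u = 0 := by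
  have hc : Filter.Tendsto (extChartAt (𝓡 n) x).symm (nhds (extChartAt (𝓡 n) x x)) (nhds x) := by
    simpa only [ContinuousAt, extChartAt_to_inv] using continuousAt_extChartAt_symm (I := 𝓡 n) x
  have h : IsLocalExtr (g ∘ (extChartAt (𝓡 n) x).symm) (extChartAt (𝓡 n) x x) :=
    IsExtrFilter.comp_tendsto (b := extChartAt (𝓡 n) x x)
      (by rw [extChartAt_to_inv]; exact hx) hc
  rw [ψ.tangentialDeriv_eq hg, h.fderiv_eq_zero]
  rfl

variable {ψ : SphereImmersion n p M} {a : EuclideanSpace ℝ (Fin (n + p + 1))}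

/-- Differentiating `a^⊥ = 0` gives `II(v^T, a^T) = 0`. -/
theorem normalProj_dProj_eq_zero (ha : ∀ x, ψ.normalProj x a = 0) (x : M)
    (v : EuclideanSpace ℝ (Fin (n + p + 1))) : ψ.normalProj x (ψ.dProj x v a) = 0 := by
  have h := ψ.normalProj_tangentialDeriv_normalProj x v a
  simp only [ha, tangentialDeriv_const, map_zero] at h
  exact neg_eq_zero.1 h.symm

theorem normalProj_dProj_eq_zero_left (ha : ∀ x, ψ.normalProj x a = 0) (x : M)
    (v : EuclideanSpace ℝ (Fin (n + p + 1))) : ψ.normalProj x (ψ.dProj x a v) = 0 := by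
  rw [normalProj_dProj_comm, normalProj_dProj_eq_zero ha]

theorem tangentProj_dProj_left (ha : ∀ x, ψ.normalProj x a = 0) (x : M)
    (w : EuclideanSpace ℝ (Fin (n + p + 1))) :
    ψ.tangentProj x (ψ.dProj x a w) = -(⟪ψ.pos x, w⟫ • ψ.tangentProj x a) := by
  have h : ψ.tangentProj x (ψ.dProj x a (ψ.normalProj x w)) = 0 := by
    rw [← inner_self_eq_zero (𝕜 := ℝ), inner_tangentProj, tangentProj_tangentProj, inner_dProj,
      inner_normalProj, normalProj_dProj_eq_zero_left ha, inner_zero_right]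
  conv_lhs => rw [ψ.eq_add_normalProj x w]
  simp [h, tangentProj_dProj_tangentProj, dProj_pos, tangentProj_tangentProj]

theorem normalProj_ddProj_eq_zero (ha : ∀ x, ψ.normalProj x a = 0) (x : M)
    (v w : EuclideanSpace ℝ (Fin (n + p + 1))) : ψ.normalProj x (ψ.ddProj x v a w) = 0 := by
  have h := ψ.normalProj_tangentialDeriv_normalProj_apply (ψ.contMDiff_dProj_apply a w) x v
  simp only [normalProj_dProj_eq_zero_left ha, tangentialDeriv_const, map_zero,
    tangentialDeriv_dProj_apply_const] at h
  rw [← normalProj_dProj, tangentProj_dProj_left ha] at h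
  simpa [normalProj_dProj, normalProj_dProj_eq_zero ha] using h.symm

/-- Interchanging the two derivatives leaves `N P''_{v,a}`, which vanishes, and `P'` along the
bracket of `a^T` and `v^T`. That bracket is `f v^T - ⟨ψ, v⟩ a^T` with `f = ⟨ψ, a⟩`, and its second
term contributes nothing. -/
theorem normalProj_ddProj_left (ha : ∀ x, ψ.normalProj x a = 0) (x : M)
    (v w : EuclideanSpace ℝ (Fin (n + p + 1))) :
    ψ.normalProj x (ψ.ddProj x a v w) = ⟪ψ.pos x, a⟫ • ψ.normalProj x (ψ.dProj x v w) := by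
  have h1 : ψ.tangentProj x (ψ.projBracket x a v) =
      ⟪ψ.pos x, a⟫ • ψ.tangentProj x v - ⟪ψ.pos x, v⟫ • ψ.tangentProj x a := by
    have h2 : ψ.tangentProj x (ψ.dProj x v a) = -(⟪ψ.pos x, a⟫ • ψ.tangentProj x v) := by
      have h3 := congrArg (fun b => ψ.tangentProj x (ψ.dProj x v b)) (ψ.eq_add_normalProj x a)
      simpa [ha, tangentProj_dProj_tangentProj, dProj_pos, tangentProj_tangentProj] using h3
    have h4 : ψ.projBracket x a v = ψ.dProj x a v - ψ.dProj x v a := rfl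
    rw [h4, map_sub, h2, tangentProj_dProj_left ha]
    abel
  have h5 : ψ.dProj x (ψ.projBracket x a v) =
      ⟪ψ.pos x, a⟫ • ψ.dProj x v - ⟪ψ.pos x, v⟫ • ψ.dProj x a := by
    rw [← dProj_tangentProj, h1, ← ψ.dProj_tangentProj x v, ← ψ.dProj_tangentProj x a]
    simp only [dProj, tangentialDeriv_sub_right, tangentialDeriv_smul_right]
  have h6 := congrArg (fun A => ψ.normalProj x (A w)) (ψ.ddProj_comm x a v)
  simp only [h5] at h6
  simpa [normalProj_ddProj_eq_zero ha, normalProj_dProj_eq_zero_left ha] using h6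

/-- If the normal part of a nonzero constant vector vanishes on a compact immersed submanifold,
the submanifold is totally geodesic. -/
theorem isTotallyGeodesic_of_normalProj_eq_zero [CompactSpace M]
    (ha : ∀ x, ψ.normalProj x a = 0) (ha0 : a ≠ 0) : ψ.IsTotallyGeodesic := by
  suffices H : ∀ v w x, ψ.normalProj x (ψ.dProj x v w) = 0 by
    intro x u w
    rw [secondFundamentalForm_eq, H]
  intro v w
  set B : M → EuclideanSpace ℝ (Fin (n + p + 1)) := fun y => ψ.normalProj y (ψ.dProj y v w) with hB
  have hBs : ContMDiff (𝓡 n) 𝓘(ℝ, EuclideanSpace ℝ (Fin (n + p + 1))) ∞ B :=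
    ψ.contMDiff_normalProj.clm_apply (ψ.contMDiff_dProj_apply v w)
  set f : M → ℝ := fun y => ⟪ψ.pos y, a⟫ with hf
  have hfs : ContMDiff (𝓡 n) 𝓘(ℝ, ℝ) ∞ f := ψ.contMDiff_pos.inner_euclidean contMDiff_const
  have hSs : ContMDiff (𝓡 n) 𝓘(ℝ, ℝ) ∞ (fun y => ⟪B y, B y⟫) := hBs.inner_euclidean hBs
  have hgs : ContMDiff (𝓡 n) 𝓘(ℝ, ℝ) ∞ (fun y => f y • ⟪B y, B y⟫) := hfs.smul hSs
  have h1 : ∀ x, ψ.normalProj x (ψ.tangentialDeriv B x a) = f x • B x := fun x => by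
    rw [hB, ψ.normalProj_tangentialDeriv_normalProj_apply (ψ.contMDiff_dProj_apply v w),
      tangentialDeriv_dProj_apply_const, normalProj_ddProj_left ha,
      normalProj_dProj_eq_zero_left ha, sub_zero]
  have h2 : ∀ x, ψ.tangentialDeriv (fun y => ⟪B y, B y⟫) x a = 2 * f x * ⟪B x, B x⟫ := fun x => by
    have hN : ψ.normalProj x (B x) = B x := ψ.normalProj_normalProj x _
    have h3 : ⟪B x, ψ.tangentialDeriv B x a⟫ = f x * ⟪B x, B x⟫ := by
      rw [← hN, inner_normalProj, h1, hN, inner_smul_right]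
    rw [ψ.tangentialDeriv_inner hBs hBs, real_inner_comm, h3]
    ring
  have h4 : ∀ x, ψ.tangentialDeriv f x a = ⟪a, a⟫ - f x ^ 2 := fun x => by
    rw [hf, ψ.tangentialDeriv_inner ψ.contMDiff_pos contMDiff_const, tangentialDeriv_const,
      inner_zero_right, add_zero, tangentialDeriv_pos]
    have h5 := congrArg (fun b => ⟪b, a⟫) (ψ.eq_add_normalProj x a)
    simp only [ha, add_zero, inner_add_left, inner_smul_left] at h5
    rw [h5]
    simp only [conj_trivial]
    ring
  -- The factor `f` is there to fix the sign: `(|a|² - f²) + 2 f²` is positive even at zeros of `f`,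
  -- whereas the derivative of `|B|²` alone has the sign of `f`.
  have h6 : ∀ x, ψ.tangentialDeriv (fun y => f y • ⟪B y, B y⟫) x a =
      (⟪a, a⟫ + f x ^ 2) * ⟪B x, B x⟫ := fun x => by
    rw [ψ.tangentialDeriv_smul hfs hSs, h2, h4, smul_eq_mul, smul_eq_mul]
    ring
  have haa : 0 < ⟪a, a⟫ := real_inner_self_pos.2 ha0
  have h7 : ∀ x, IsLocalExtr (fun y => f y • ⟪B y, B y⟫) x → ⟪B x, B x⟫ = 0 := fun x hx => by
    have h := ψ.tangentialDeriv_eq_zero_of_isLocalExtr hgs hx a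
    rw [h6] at h
    exact (mul_eq_zero.1 h).resolve_left (by positivity)
  intro x
  obtain ⟨x₁, -, hx₁⟩ := isCompact_univ.exists_isMaxOn ⟨x, Set.mem_univ x⟩
    hgs.continuous.continuousOn
  obtain ⟨x₂, -, hx₂⟩ := isCompact_univ.exists_isMinOn ⟨x, Set.mem_univ x⟩
    hgs.continuous.continuousOn
  have e₁ := h7 x₁ (Or.inr (hx₁.isLocalMax Filter.univ_mem))
  have e₂ := h7 x₂ (Or.inl (hx₂.isLocalMin Filter.univ_mem))
  -- Both the maximum and the minimum value are zero.
  have h8 : ∀ y, f y • ⟪B y, B y⟫ = 0 := fun y => by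
    have l₁ := hx₁ (Set.mem_univ y)
    have l₂ := hx₂ (Set.mem_univ y)
    simp only [Set.mem_ofPred_eq, e₁, e₂, smul_zero] at l₁ l₂
    exact le_antisymm l₁ l₂
  have h9 := h6 x
  simp only [h8, tangentialDeriv_const] at h9
  exact inner_self_eq_zero.1 ((mul_eq_zero.1 h9.symm).resolve_left (by positivity))

theorem constNormal_injective [CompactSpace M] (hng : ¬ ψ.IsTotallyGeodesic) :
    Function.Injective ψ.constNormal := by
  rw [injective_iff_map_eq_zero]
  intro a h
  by_contra ha0
  exact hng (isTotallyGeodesic_of_normalProj_eq_zero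
    (fun x => congrFun (congrArg Subtype.val h) x) ha0)

end SphereImmersion


/-! ### The Riemannian measure is finite and charges open sets -/

namespace SphereImmersion

variable {n p : ℕ} {M : Type*} [TopologicalSpace M]
  [ChartedSpace (EuclideanSpace ℝ (Fin n)) M]

/-- The inverse chart is controlled only on its target, which carries the measure. Without a.e.
measurability `Measure.map` would be zero by default. -/
theorem aemeasurable_extChartAt_symm [MeasurableSpace M] [BorelSpace M]
    (ψ : SphereImmersion n p M) (c : M) :
    AEMeasurable (extChartAt (𝓡 n) c).symm
      ((volume.restrict (extChartAt (𝓡 n) c).target).withDensity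
        fun y => ENNReal.ofReal (ψ.chartDensity c y)) :=
  ((continuousOn_extChartAt_symm c).aemeasurable
    (isOpen_extChartAt_target c).measurableSet).mono_ac (withDensity_absolutelyContinuous _ _)

variable [IsManifold (𝓡 n) ∞ M]

theorem chartDensity_pos (ψ : SphereImmersion n p M) (c : M) {y : EuclideanSpace ℝ (Fin n)}
    (hy : y ∈ (extChartAt (𝓡 n) c).target) : 0 < ψ.chartDensity c y := by
  have hl : LinearIndependent ℝ
      (fun i : Fin n => ψ.chartDpos c y (EuclideanSpace.single i (1 : ℝ))) := by
    have := (EuclideanSpace.basisFun (Fin n) ℝ).toBasis.linearIndependent.map'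
      (ψ.chartDpos c y).toLinearMap (LinearMap.ker_eq_bot.2 (ψ.chartDpos_injective c hy))
    simpa [Function.comp_def] using this
  exact Real.sqrt_pos.2 (Matrix.posDef_gram_of_linearIndependent hl).det_pos

theorem continuousOn_chartDensity (ψ : SphereImmersion n p M) (c : M) :
    ContinuousOn (ψ.chartDensity c) (extChartAt (𝓡 n) c).target := by
  have h : ContinuousOn (ψ.chartDpos c) (extChartAt (𝓡 n) c).target := fun z hz =>
    (ψ.contDiffAt_chartDpos c hz).continuousAt.continuousWithinAt
  have h' : ∀ i : Fin n, ContinuousOn (fun z => ψ.chartDpos c z (EuclideanSpace.single i (1 : ℝ)))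
    (extChartAt (𝓡 n) c).target := fun i => h.clm_apply continuousOn_const
  have hd : ContinuousOn (fun z => Matrix.of fun i j : Fin n =>
      ⟪ψ.chartDpos c z (EuclideanSpace.single i (1 : ℝ)),
        ψ.chartDpos c z (EuclideanSpace.single j (1 : ℝ))⟫) (extChartAt (𝓡 n) c).target :=
    continuousOn_pi.2 fun i => continuousOn_pi.2 fun j => (h' i).inner (h' j)
  exact Real.continuous_sqrt.comp_continuousOn (continuous_id.matrix_det.comp_continuousOn hd)

theorem aemeasurable_chartDensity (ψ : SphereImmersion n p M) (c : M) :
    AEMeasurable (fun y => ENNReal.ofReal (ψ.chartDensity c y))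
      (volume.restrict (extChartAt (𝓡 n) c).target) :=
  ((ψ.continuousOn_chartDensity c).aemeasurable
    (isOpen_extChartAt_target c).measurableSet).ennreal_ofReal

variable [MeasurableSpace M] [BorelSpace M]

theorem chartVolume_lt_top (ψ : SphereImmersion n p M) (c : M) {K : Set M} (hK : IsCompact K)
    (hm : MeasurableSet K) (hKs : K ⊆ (extChartAt (𝓡 n) c).source) : ψ.chartVolume c K < ⊤ := by
  set φ := extChartAt (𝓡 n) c with hφ
  have hc : IsCompact (φ '' K) :=
    hK.image_of_continuousOn ((continuousOn_extChartAt c).mono hKs)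
  have ht : φ '' K ⊆ φ.target := by
    rintro _ ⟨y, hy, rfl⟩
    exact φ.map_source (hKs hy)
  have hi : IntegrableOn (ψ.chartDensity c) (φ '' K) :=
    ((ψ.continuousOn_chartDensity c).mono ht).integrableOn_compact hc
  rw [chartVolume, Measure.map_apply_of_aemeasurable (ψ.aemeasurable_extChartAt_symm c) hm]
  have hsub : φ.symm ⁻¹' K ∩ φ.target ⊆ φ '' K := fun z hz => ⟨_, hz.1, φ.right_inv hz.2⟩
  set ν := (volume.restrict φ.target).withDensity fun y => ENNReal.ofReal (ψ.chartDensity c y)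
  -- The preimage of `K` may contain stray points outside the target; they form a null set.
  have hν : ν φ.targetᶜ = 0 := by
    refine withDensity_absolutelyContinuous _ _ ?_
    rw [Measure.restrict_apply (isOpen_extChartAt_target c).measurableSet.compl,
      Set.compl_inter_self, measure_empty]
  calc ν (φ.symm ⁻¹' K) ≤ ν (φ '' K ∪ φ.targetᶜ) := measure_mono fun z hz => by
        by_cases h : z ∈ φ.target
        · exact Or.inl (hsub ⟨hz, h⟩)
        · exact Or.inr h
    _ ≤ ν (φ '' K) + ν φ.targetᶜ := measure_union_le _ _
    _ = ∫⁻ y in φ '' K, ENNReal.ofReal (ψ.chartDensity c y) := by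
        rw [hν, add_zero, withDensity_apply _ hc.measurableSet,
          Measure.restrict_restrict hc.measurableSet, Set.inter_eq_left.2 ht]
    _ < ⊤ := hi.lintegral_lt_top

theorem chartVolume_ne_zero (ψ : SphereImmersion n p M) (c : M) {W : Set M} (hW : IsOpen W)
    {x : M} (hx : x ∈ W) (hxs : x ∈ (extChartAt (𝓡 n) c).source) : ψ.chartVolume c W ≠ 0 := by
  rw [chartVolume, Measure.map_apply_of_aemeasurable (ψ.aemeasurable_extChartAt_symm c)
    hW.measurableSet]
  rw [Ne, withDensity_apply_eq_zero' (ψ.aemeasurable_chartDensity c)]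
  intro h
  have ho : IsOpen ((extChartAt (𝓡 n) c).target ∩ (extChartAt (𝓡 n) c).symm ⁻¹' W) :=
    (continuousOn_extChartAt_symm c).isOpen_inter_preimage (isOpen_extChartAt_target c) hW
  have hne : ((extChartAt (𝓡 n) c).target ∩ (extChartAt (𝓡 n) c).symm ⁻¹' W).Nonempty :=
    ⟨extChartAt (𝓡 n) c x, (extChartAt (𝓡 n) c).map_source hxs, by
      rwa [Set.mem_preimage, (extChartAt (𝓡 n) c).left_inv hxs]⟩
  refine (ho.measure_pos volume hne).ne' ?_
  rw [Measure.restrict_apply' (isOpen_extChartAt_target c).measurableSet] at h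
  refine measure_mono_null (fun z hz => ?_) h
  exact ⟨⟨by simpa using ψ.chartDensity_pos c hz.1, hz.2⟩, hz.1⟩

variable [CompactSpace M] [T2Space M]

/-- By compactness only finitely many `ρ_c` are nonzero, and each is at most one with compact
support inside its chart. -/
instance isFiniteMeasure_riemannianVolume (ψ : SphereImmersion n p M) :
    IsFiniteMeasure ψ.riemannianVolume := by
  constructor
  rw [riemannianVolume]
  set ρ := (SmoothPartitionOfUnity.exists_isSubordinate_chartAt_source (𝓡 n) M).choose with hρ
  have hsub := (SmoothPartitionOfUnity.exists_isSubordinate_chartAt_source (𝓡 n) M).choose_spec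
  rw [← hρ] at hsub
  have hfin : {c | (Function.support (ρ c)).Nonempty}.Finite :=
    ρ.locallyFinite.finite_nonempty_of_compact
  rw [Measure.sum_apply _ MeasurableSet.univ, tsum_eq_sum (s := hfin.toFinset)]
  · refine ENNReal.sum_lt_top.2 fun c _ => ?_
    have hcl : IsClosed (tsupport (ρ c)) := isClosed_tsupport _
    have hlt := ψ.chartVolume_lt_top c hcl.isCompact hcl.measurableSet
      (by rw [extChartAt_source]; exact hsub c)
    rw [withDensity_apply _ MeasurableSet.univ, Measure.restrict_univ]
    refine lt_of_le_of_lt (lintegral_mono (g := (tsupport (ρ c)).indicator 1) fun x => ?_) ?_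
    · by_cases hx : x ∈ tsupport (ρ c)
      · simpa [hx] using ρ.le_one c x
      · simp [hx, image_eq_zero_of_notMem_tsupport hx]
    · rwa [lintegral_indicator_one hcl.measurableSet]
  · intro c hc
    have h0 : ∀ x, ρ c x = 0 := by
      by_contra! h
      exact hc (hfin.mem_toFinset.2 h)
    simp [h0]

/-- Near a given point some `ρ_c` is positive, and there the chart density is positive as well. -/
instance isOpenPosMeasure_riemannianVolume (ψ : SphereImmersion n p M) :
    ψ.riemannianVolume.IsOpenPosMeasure := by
  refine ⟨fun U hU ⟨x, hx⟩ h0 => ?_⟩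
  rw [riemannianVolume] at h0
  set ρ := (SmoothPartitionOfUnity.exists_isSubordinate_chartAt_source (𝓡 n) M).choose with hρ
  have hsub := (SmoothPartitionOfUnity.exists_isSubordinate_chartAt_source (𝓡 n) M).choose_spec
  rw [← hρ] at hsub
  obtain ⟨c, hc⟩ := ρ.exists_pos_of_mem (Set.mem_univ x)
  have hcont : Continuous (ρ c) := (ρ c).contMDiff.continuous
  have h1 := Measure.absolutelyContinuous_of_le (Measure.le_sum
    (fun c => (ψ.chartVolume c).withDensity fun x => ENNReal.ofReal (ρ c x)) c) h0
  rw [withDensity_apply_eq_zero' hcont.measurable.ennreal_ofReal.aemeasurable] at h1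
  have hW : x ∈ {y | 0 < ρ c y} ∩ U := ⟨hc, hx⟩
  refine ψ.chartVolume_ne_zero c ((isOpen_lt continuous_const hcont).inter hU) hW ?_ ?_
  · rw [extChartAt_source]
    exact hsub c (subset_tsupport _ hc.ne')
  · have hs : {y | 0 < ρ c y} ∩ U ⊆ {y | ENNReal.ofReal (ρ c y) ≠ 0} ∩ U :=
      fun y hy => ⟨(ENNReal.ofReal_pos.2 hy.1).ne', hy.2⟩
    exact measure_mono_null hs h1

/-- The integrand is `n |a^⊥|²`: continuous, nonnegative and nonzero somewhere, hence of positive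
integral. -/
theorem IsMinimal.indexForm_constNormal_neg {ψ : SphereImmersion n p M} (hmin : ψ.IsMinimal)
    (hn : n ≠ 0) {a : EuclideanSpace ℝ (Fin (n + p + 1))} (ha : ψ.constNormal a ≠ 0) :
    ψ.indexForm (ψ.constNormal a) < 0 := by
  have hc : Continuous (ψ.constNormal a).1 := (ψ.constNormal a).2.1.continuous
  have hn' : (0 : ℝ) < n := by positivity
  rw [indexForm, neg_lt_zero]
  simp only [hmin.jacobi_constNormal hn, inner_smul_left, conj_trivial]
  obtain ⟨x, hx⟩ : ∃ x, (ψ.constNormal a).1 x ≠ 0 := by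
    by_contra! h
    exact ha (Subtype.ext (funext h))
  refine Continuous.integral_pos_of_hasCompactSupport_nonneg_nonzero (x := x)
    (continuous_const.mul (hc.inner hc)) (HasCompactSupport.of_compactSpace _)
    (fun y => mul_nonneg hn'.le real_inner_self_nonneg) ?_
  exact (mul_pos hn' (real_inner_self_pos.2 hx)).ne'

end SphereImmersion

end

theorem lemma4p6 {n p : ℕ} {M : Type*} [TopologicalSpace M]
    [ChartedSpace (EuclideanSpace ℝ (Fin n)) M] [IsManifold (𝓡 n) ∞ M]
    [CompactSpace M] [T2Space M] [MeasurableSpace M] [BorelSpace M]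
    (ψ : SphereImmersion n p M) (hmin : ψ.IsMinimal) (hng : ¬ ψ.IsTotallyGeodesic) :
    ((n + p + 1 : ℕ) : Cardinal) ≤ Module.rank ℝ (ψ.eigenspace (-(n : ℝ))) ∧
      ((n + p + 1 : ℕ) : Cardinal) ≤ ψ.index ∧
      ((n + p + 1 : ℕ) : Cardinal) ≤ ψ.spectralIndex := by
  have hn : n ≠ 0 := fun h => hng (.of_dim_eq_zero h)
  have hinj := SphereImmersion.constNormal_injective hng
  have hrange : Module.rank ℝ (LinearMap.range ψ.constNormal) = ((n + p + 1 : ℕ) : Cardinal) := by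
    -- The two ranks may live in different universes; both equal a natural number, so the lifts
    -- disappear.
    have h := (LinearEquiv.ofInjective _ hinj).lift_rank_eq
    rw [← Module.finrank_eq_rank ℝ (EuclideanSpace ℝ (Fin (n + p + 1))),
      finrank_euclideanSpace_fin, Cardinal.lift_natCast] at h
    exact (Cardinal.lift_eq_nat_iff.1 h.symm)
  have hle : LinearMap.range ψ.constNormal ≤ ψ.eigenspace (-(n : ℝ)) := by
    rintro _ ⟨a, rfl⟩
    refine Submodule.subset_span fun x => ?_
    rw [hmin.jacobi_constNormal hn, neg_smul, add_neg_cancel]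
  have heig : ((n + p + 1 : ℕ) : Cardinal) ≤ Module.rank ℝ (ψ.eigenspace (-(n : ℝ))) :=
    hrange ▸ Submodule.rank_mono hle
  refine ⟨heig, ?_, ?_⟩
  · rw [← hrange]
    -- A supremum of cardinals bounds its terms only for a bounded family; here the index type is
    -- small.
    refine le_ciSup (f := fun W : {W : Submodule ℝ ψ.normalSections //
      ∀ V ∈ W, V ≠ 0 → ψ.indexForm V < 0} => Module.rank ℝ W.1) Cardinal.bddAbove_of_small
      ⟨LinearMap.range ψ.constNormal, ?_⟩
    rintro _ ⟨a, rfl⟩ ha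
    exact hmin.indexForm_constNormal_neg hn ha
  · have hneg : -(n : ℝ) ∈ Set.Iio (0 : ℝ) := by
      rw [Set.mem_Iio, neg_lt_zero]
      positivity
    exact heig.trans (by
      simpa using! Cardinal.le_sum (fun μ : Set.Iio (0 : ℝ) => Module.rank ℝ (ψ.eigenspace μ))
        ⟨-(n : ℝ), hneg⟩)
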